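/- Let $(W,S)$ be a Coxeter system with length function $\ell$. Let $K$ be a commutative ring and $(q_s)_{s\in S}$ a family of units of $K$ with $q_s=q_t$ whenever $s,t\in S$ are conjugate in $W$ (for example $K=\mathbb{Q}(\{q_s\})$ with the $q_s$, one for each conjugacy class of generators, indeterminates). Let $\mathscr H$ be the Hecke algebra of $(W,S)$, the $K$-algebra with generators $H_s$ ($s\in S$) subject to the braid relations and $(H_s-q_s)(H_s+q_s^{-1})=0$; for a reduced expression $w=t_1\cdots t_k$ put $H_w=H_{t_1}\cdots H_{t_k}$. Suppose that $s_0,\dots,s_{d-1}\in S$ generate a parabolic subgroup $W_d\subset W$ of type $B_d$, the bond of label $4$ joining $s_0$ and $s_1$. Write $q_{s_0}=p$, $q_{s_i}=q$ for $i\ge 1$, and let $\mathscr H_{B_d}$ be the Hecke algebra of type $B_d$ with generators $H_0,\dots,H_{d-1}$ and these parameters; it maps to $\mathscr H$ by $H_i\mapsto H_{s_i}$. For integers $r,m\ge 0$ let $\mathbb I=\{\frac{1-n}2,\frac{3-n}2,\dots,\frac{n-1}2\}$ with $n=2r+m$, let $\mathbb I_\bullet=\{a\in\mathbb I:\frac{1-m}2\le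 a\le\frac{m-1}2\}$, and let $\mathbb I_\circ^{+}=\{a\in\mathbb I: a\ge\frac{m+1}2\}$, $\mathbb I_\circ^-=-\mathbb I_\circ^+$. The group $W_d$ acts on $\mathbb I^d$ from the right: for $i\ge1$, $f\cdot s_i$ is $f$ with the entries $f(i)$ and $f(i+1)$ exchanged; $f\cdot s_0$ is $f$ with $f(1)$ replaced by $-f(1)$ if $f(1)\notin\mathbb I_\bullet$, and $f\cdot s_0=f$ if $f(1)\in\mathbb I_\bullet$. Let $\mathbb V$ be the free $K$-module with basis $v_a$ ($a\in\mathbb I$), and let $M_f=v_{f(1)}\otimes\cdots\otimes v_{f(d)}\in\mathbb V^{\otimes d}$. Then $\mathbb V^{\otimes d}$ is a right $\mathscr H_{B_d}$-module in which, for $i\ge1$, $M_fH_i$ equals $M_{f\cdot s_i}+(q-q^{-1})M_f$, $M_{f\cdot s_i}$ or $qM_f$ according as $f(i)<f(i+1)$, $f(i)>f(i+1)$ or $f(i)=f(i+1)$, and $M_fH_0$ equals $M_{f\cdot s_0}+(p-p^{-1})M_f$, $M_{f\cdot s_0}$ or $pM_f$ according as $f(1)\in\mathbb I_\circ^+$,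 $f(1)\in\mathbb I_\circ^-$ or $f(1)\in\mathbb I_\bullet$. Fix $f\in\mathbb I^d$ with $\frac{m-1}2\ge f(1)\ge\cdots\ge f(d)$, let $W_f\subset W_d$ be its stabilizer (a quasi-parabolic subgroup $W_{m_1}\times\cdots\times W_{m_k}\times S_{m_{k+1}}\times\cdots\times S_{m_l}$; every quasi-parabolic subgroup arises in this way), and let $\mathbb M_f=M_f\mathscr H_{B_d}$. Let ${}^fW_d$, ${}^dW$ and ${}^fW$ be the sets of minimal length right coset representatives of $W_f$ in $W_d$, of $W_d$ in $W$ and of $W_f$ in $W$, respectively. Consider the induced right $\mathscr H$-module $\mathcal M=\mathbb M_f\otimes_{\mathscr H_{B_d}}\mathscr H$. Then $(\sigma,x)\mapsto\sigma x$ is a bijection ${}^fW_d\times{}^dW\to{}^fW$, the elements $m_{\sigma x}=M_{f\cdot\sigma}\otimes H_x$ ($\sigma\in{}^fW_d$, $x\in{}^dW$) form a $K$-basis $(m_w)_{w\in{}^fW}$ of $\mathcal M$, and for all $w\in{}^fW$ and $s\in S$ $$m_wH_s=\begin{cases} m_{ws}+(q_s-q_s^{-1})\,m_w,&\text{if }\ell(ws)<\ell(w)\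 (\text{and then } ws\in{}^fW),\\ m_{ws},&\text{if }\ell(ws)>\ell(w)\text{ and }ws\in{}^fW,\\ q_s\,m_w,&\text{if }\ell(ws)>\ell(w)\text{ and }ws\notin{}^fW.\end{cases}$$ -/

import Mathlib

open scoped TensorProduct
open MulOpposite

noncomputable section

namespace QuasiParabolic

/-! ### The Iwahori-Hecke algebra of a Coxeter matrix -/

section Hecke

variable (K : Type*) [CommRing K] {B : Type*}

/-- The quadratic relations `(H_s - q_s)(H_s + q_s⁻¹) = 0` and the braid relations
`H_s H_t H_s ⋯ = H_t H_s H_t ⋯` (`M s t` factors on both sides, for `M s t` finite; the value `0`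
of a Coxeter matrix stands for `∞`). -/
inductive HeckeRel (M : CoxeterMatrix B) (q : B → Kˣ) : FreeAlgebra K B → FreeAlgebra K B → Prop
  | quadratic (s : B) : HeckeRel M q
      ((FreeAlgebra.ι K s - algebraMap K _ (q s : K)) *
        (FreeAlgebra.ι K s + algebraMap K _ (((q s)⁻¹ : Kˣ) : K))) 0
  | braid (s t : B) (h : M s t ≠ 0) : HeckeRel M q
      ((CoxeterSystem.braidWord M s t).map (FreeAlgebra.ι K)).prod
      ((CoxeterSystem.braidWord M t s).map (FreeAlgebra.ι K)).prod

/-- The Hecke algebra over `K` of the Coxeter matrix `M` with invertible parameters `q s`. -/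
def HeckeAlgebra (M : CoxeterMatrix B) (q : B → Kˣ) : Type _ := RingQuot (HeckeRel K M q)

variable {K}

instance (M : CoxeterMatrix B) (q : B → Kˣ) : Ring (HeckeAlgebra K M q) :=
  inferInstanceAs (Ring (RingQuot (HeckeRel K M q)))

instance (M : CoxeterMatrix B) (q : B → Kˣ) : Algebra K (HeckeAlgebra K M q) :=
  inferInstanceAs (Algebra K (RingQuot (HeckeRel K M q)))

namespace HeckeAlgebra

/-- The generator `H_s`. -/
def gen (M : CoxeterMatrix B) (q : B → Kˣ) (s : B) : HeckeAlgebra K M q :=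
  RingQuot.mkAlgHom K (HeckeRel K M q) (FreeAlgebra.ι K s)

theorem gen_quadratic (M : CoxeterMatrix B) (q : B → Kˣ) (s : B) :
    (gen M q s - algebraMap K _ (q s : K)) *
      (gen M q s + algebraMap K _ (((q s)⁻¹ : Kˣ) : K)) = 0 := by
  have h := RingQuot.mkAlgHom_rel K (HeckeRel.quadratic (K := K) (M := M) (q := q) s)
  rw [map_mul, map_sub, map_add, map_zero, AlgHom.commutes, AlgHom.commutes] at h
  exact h

theorem gen_braid (M : CoxeterMatrix B) (q : B → Kˣ) (s t : B) (hst : M s t ≠ 0) :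
    ((CoxeterSystem.braidWord M s t).map (gen M q)).prod =
      ((CoxeterSystem.braidWord M t s).map (gen M q)).prod := by
  have h := RingQuot.mkAlgHom_rel K (HeckeRel.braid (K := K) (M := M) (q := q) s t hst)
  rw [map_list_prod, map_list_prod, List.map_map, List.map_map] at h
  exact h

/-- Universal property: a family satisfying the defining relations induces an algebra map. -/
def lift {A : Type*} [Ring A] [Algebra K A] (M : CoxeterMatrix B) (q : B → Kˣ) (a : B → A)
    (hquad : ∀ s, (a s - algebraMap K A (q s : K)) *
      (a s + algebraMap K A (((q s)⁻¹ : Kˣ) : K)) = 0)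
    (hbraid : ∀ s t, M s t ≠ 0 → ((CoxeterSystem.braidWord M s t).map a).prod =
      ((CoxeterSystem.braidWord M t s).map a).prod) :
    HeckeAlgebra K M q →ₐ[K] A :=
  RingQuot.liftAlgHom K ⟨FreeAlgebra.lift K a, by
    intro x y h
    cases h with
    | quadratic s => simpa using hquad s
    | braid s t hst =>
      rw [map_list_prod, map_list_prod, List.map_map, List.map_map]
      have : (⇑(FreeAlgebra.lift K a) ∘ FreeAlgebra.ι K : B → A) = a := by
        ext b; simp
      rw [this]
      exact hbraid s t hst⟩

@[simp] theorem lift_gen {A : Type*} [Ring A] [Algebra K A] (M : CoxeterMatrix B) (q : B → Kˣ)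
    (a : B → A) (hquad hbraid) (s : B) : lift M q a hquad hbraid (gen M q s) = a s := by
  unfold lift gen
  exact (RingQuot.liftAlgHom_mkAlgHom_apply K _ _ _).trans (by simp)

/-- The basis element `H_w = H_{s₁} ⋯ H_{sₖ}`, where `w = s₁ ⋯ sₖ` is a reduced expression. By the
braid relations (Matsumoto's theorem) it does not depend on the reduced expression chosen. -/
def basisElt {W : Type*} [Group W] {M : CoxeterMatrix B} (cs : CoxeterSystem M W) (q : B → Kˣ)
    (w : W) : HeckeAlgebra K M q :=
  ((cs.exists_isReduced w).choose.map (gen M q)).prod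

theorem map_braidWord {B' : Type*} {M : CoxeterMatrix B} {M' : CoxeterMatrix B'} (j : B → B')
    (hj : ∀ a b, M' (j a) (j b) = M a b) (a b : B) :
    CoxeterSystem.braidWord M' (j a) (j b) = (CoxeterSystem.braidWord M a b).map j := by
  unfold CoxeterSystem.braidWord
  rw [hj]
  generalize M a b = n
  induction n generalizing a b with
  | zero => rfl
  | succ n ih => simp [CoxeterSystem.alternatingWord_succ, ih]

/-- The algebra map `H_a ↦ H_{j a}` attached to a full subdiagram `j` of a Coxeter diagram. -/
def parabolicMap {B' : Type*} {M : CoxeterMatrix B} {M' : CoxeterMatrix B'} {q : B → Kˣ}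
    {q' : B' → Kˣ} (j : B → B') (hj : ∀ a b, M' (j a) (j b) = M a b)
    (hq : ∀ a, q' (j a) = q a) : HeckeAlgebra K M q →ₐ[K] HeckeAlgebra K M' q' :=
  lift M q (fun a => gen M' q' (j a))
    (fun a => by simpa only [hq] using gen_quadratic M' q' (j a))
    (fun a b hab => by
      have h := gen_braid M' q' (j a) (j b) (by rwa [hj])
      rw [map_braidWord j hj, map_braidWord j hj, List.map_map, List.map_map] at h
      exact h)

end HeckeAlgebra

end Hecke

/-! ### Coset representatives, parabolic subgroups, induced modules -/

/-- The set of minimal length right coset representatives of the subgroup `G`: all `w` that have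
minimal length in the coset `G w`. -/
def minReps {B W : Type*} [Group W] {M : CoxeterMatrix B} (cs : CoxeterSystem M W)
    (G : Subgroup W) : Set W :=
  {w | ∀ u ∈ G, cs.length w ≤ cs.length (u * w)}

/-- The homomorphism `s_a ↦ s_{j a}` from the Coxeter group of a full subdiagram `j`; it identifies
that group with the standard parabolic subgroup generated by the `s_{j a}`. -/
def parabolicHom {B B' W : Type*} [Group W] {M : CoxeterMatrix B} {M' : CoxeterMatrix B'}
    (cs : CoxeterSystem M' W) (j : B → B') (hj : ∀ a b, M' (j a) (j b) = M a b) : M.Group →* W :=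
  M.toCoxeterSystem.lift ⟨fun a => cs.simple (j a), fun a b => by
    rw [← hj a b]; exact cs.simple_mul_simple_pow (j a) (j b)⟩

section Induced

variable {K A H : Type*} [CommRing K] [Ring A] [Algebra K A] [Ring H] [Algebra K H]
  (ι : A →ₐ[K] H) (N : Type*) [AddCommGroup N] [Module K N] [Module Aᵐᵒᵖ N]

/-- The induced right `H`-module `N ⊗_A H` of a right `A`-module `N` along `ι : A → H`: the quotient
of the tensor product of `N` and `H` over `K` by the relations `n a ⊗ h = n ⊗ ι(a) h`. The two
factors are written in the opposite order, so that right multiplication of `H` on itself gives the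
right `H`-module structure (a left module structure over the opposite ring). -/
def InducedModule : Type _ :=
  (H ⊗[K] N) ⧸ Submodule.span Hᵐᵒᵖ
    {z : H ⊗[K] N | ∃ (a : A) (h : H) (n : N), z = h ⊗ₜ[K] (op a • n) - (ι a * h) ⊗ₜ[K] n}

instance : AddCommGroup (InducedModule ι N) :=
  inferInstanceAs (AddCommGroup ((H ⊗[K] N) ⧸ Submodule.span Hᵐᵒᵖ _))

instance : Module Hᵐᵒᵖ (InducedModule ι N) :=
  inferInstanceAs (Module Hᵐᵒᵖ ((H ⊗[K] N) ⧸ Submodule.span Hᵐᵒᵖ _))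

instance : Module K (InducedModule ι N) :=
  inferInstanceAs (Module K ((H ⊗[K] N) ⧸ Submodule.span Hᵐᵒᵖ _))

variable {N}

/-- The class of `n ⊗ h` in `N ⊗_A H`. -/
def indTmul (n : N) (h : H) : InducedModule ι N :=
  Submodule.Quotient.mk (h ⊗ₜ[K] n)

theorem indTmul_balanced (n : N) (a : A) (h : H) :
    indTmul ι (op a • n) h = indTmul ι n (ι a * h) :=
  (Submodule.Quotient.eq _).2 (Submodule.subset_span ⟨a, h, n, rfl⟩)

theorem op_smul_indTmul (n : N) (h h' : H) :
    op h' • indTmul ι n h = indTmul ι n (h * h') := rfl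

theorem smul_indTmul (c : K) (n : N) (h : H) :
    c • indTmul ι n h = indTmul ι n (c • h) := rfl

end Induced
/-! ### Type B -/

section TypeB

/-- The Coxeter matrix of type `B_d`, with generators `s_0, s_1, …, s_{d-1}` numbered so that the
bond of label `4` joins `s_0` and `s_1`. -/
def typeB (d : ℕ) : CoxeterMatrix (Fin d) := (CoxeterMatrix.B d).reindex Fin.revPerm

theorem typeB_apply (d : ℕ) (i j : Fin d) : typeB d i j =
    if i = j then 1
    else if (i.1 = 0 ∧ j.1 = 1) ∨ (i.1 = 1 ∧ j.1 = 0) then 4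
    else if j.1 + 1 = i.1 ∨ i.1 + 1 = j.1 then 3 else 2 := by
  rw [typeB, CoxeterMatrix.reindex_apply]
  obtain ⟨i, hi⟩ := i
  obtain ⟨j, hj⟩ := j
  simp only [CoxeterMatrix.B, Matrix.of_apply, Fin.revPerm_symm, Fin.revPerm_apply, Fin.ext_iff,
    Fin.val_rev]
  split_ifs <;> first | rfl | omega

/-- The parameters of type `B_d`: `p` for `s_0` and `q` for the other generators. -/
def typeBParam {K : Type*} [CommRing K] (d : ℕ) (p q : Kˣ) (i : Fin d) : Kˣ :=
  if i.1 = 0 then p else q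

/-- The letters `𝕀_{r|m|r} = {(1-n)/2, (3-n)/2, …, (n-1)/2}`, where `n = 2r + m`, encoded in
increasing order by `Fin (2r+m)`; `letterValue` is the encoded half-integer. The negative is
`Fin.rev`. -/
abbrev Letter (r m : ℕ) : Type := Fin (2 * r + m)

/-- The half-integer encoded by a letter. -/
def letterValue {r m : ℕ} (a : Letter r m) : ℚ := (1 - ((2 * r + m : ℕ) : ℚ)) / 2 + (a.1 : ℚ)

theorem letterValue_lt_iff {r m : ℕ} (a b : Letter r m) :
    letterValue a < letterValue b ↔ a < b := by
  simp [letterValue]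

theorem letterValue_rev {r m : ℕ} (a : Letter r m) :
    letterValue a.rev = -letterValue a := by
  have h : (a.rev.1 : ℚ) + a.1 + 1 = ((2 * r + m : ℕ) : ℚ) := by
    have := a.2
    have h' : a.rev.1 + a.1 + 1 = 2 * r + m := by rw [Fin.val_rev]; omega
    exact_mod_cast h'
  unfold letterValue
  linarith

/-- The letter belongs to the middle part `𝕀_• = [(1-m)/2, (m-1)/2]`. -/
def IsMiddle {r m : ℕ} (a : Letter r m) : Prop := r ≤ a.1 ∧ a.1 < r + m

/-- The letter belongs to the positive part `𝕀_∘⁺ = [(m+1)/2, r + (m-1)/2]`. -/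
def IsUpper {r m : ℕ} (a : Letter r m) : Prop := r + m ≤ a.1

instance {r m : ℕ} (a : Letter r m) : Decidable (IsMiddle a) :=
  inferInstanceAs (Decidable (_ ∧ _))

instance {r m : ℕ} (a : Letter r m) : Decidable (IsUpper a) :=
  inferInstanceAs (Decidable (_ ≤ _))

theorem isMiddle_iff {r m : ℕ} (a : Letter r m) :
    IsMiddle a ↔ (1 - m : ℚ) / 2 ≤ letterValue a ∧ letterValue a ≤ (m - 1 : ℚ) / 2 := by
  unfold IsMiddle letterValue
  push_cast
  constructor
  · rintro ⟨h1, h2⟩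
    have h1' : (r : ℚ) ≤ a.1 := by exact_mod_cast h1
    have h2' : (a.1 : ℚ) + 1 ≤ r + m := by exact_mod_cast h2
    constructor <;> linarith
  · rintro ⟨h1, h2⟩
    have h1' : (r : ℚ) ≤ a.1 := by linarith
    have h2' : (a.1 : ℚ) + 1 ≤ r + m := by linarith
    exact ⟨by exact_mod_cast h1', by exact_mod_cast h2'⟩

theorem isUpper_iff {r m : ℕ} (a : Letter r m) :
    IsUpper a ↔ (m + 1 : ℚ) / 2 ≤ letterValue a := by
  unfold IsUpper letterValue
  push_cast
  constructor
  · intro h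
    have h' : (r + m : ℚ) ≤ a.1 := by exact_mod_cast h
    linarith
  · intro h
    have h' : (r + m : ℚ) ≤ a.1 := by linarith
    exact_mod_cast h'

/-- The position preceding `i` (only used for `i ≠ 0`). -/
def prev {d : ℕ} (i : Fin d) : Fin d := ⟨i.1 - 1, by omega⟩

/-- A word `f = (f(1), …, f(d))` in the letters; the position `k` is here `k - 1 : Fin d`. -/
abbrev LetterWord (d r m : ℕ) : Type := Fin d → Letter r m

/-- The right action `f ↦ f · s_i` of a generator on words: for `i > 0` the entries at the positions
`i` and `i + 1` (counted from `1`) are exchanged; for `i = 0` the sign of the first entry is changed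
unless this entry lies in the middle part. -/
def simpleAct {d r m : ℕ} (i : Fin d) (f : LetterWord d r m) : LetterWord d r m :=
  if i.1 = 0 then (if IsMiddle (f i) then f else Function.update f i (f i).rev)
  else f ∘ Equiv.swap (prev i) i

theorem simpleAct_zero {d r m : ℕ} (i : Fin d) (hi : i.1 = 0) (f : LetterWord d r m) :
    simpleAct i f = if IsMiddle (f i) then f else Function.update f i (f i).rev := if_pos hi

theorem simpleAct_pos {d r m : ℕ} (i : Fin d) (hi : i.1 ≠ 0) (f : LetterWord d r m) :
    simpleAct i f = f ∘ Equiv.swap (prev i) i := if_neg hi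

theorem isMiddle_rev {r m : ℕ} (a : Letter r m) : IsMiddle a.rev ↔ IsMiddle a := by
  unfold IsMiddle
  have := a.2
  rw [Fin.val_rev]
  omega

theorem isUpper_rev {r m : ℕ} (a : Letter r m) (ha : ¬ IsMiddle a) :
    IsUpper a.rev ↔ ¬ IsUpper a := by
  unfold IsMiddle at ha
  unfold IsUpper
  have := a.2
  rw [Fin.val_rev]
  omega

theorem simpleAct_simpleAct {d r m : ℕ} (i : Fin d) (f : LetterWord d r m) :
    simpleAct i (simpleAct i f) = f := by
  by_cases hi : i.1 = 0
  · rw [simpleAct_zero i hi f]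
    by_cases h : IsMiddle (f i)
    · rw [if_pos h, simpleAct_zero i hi, if_pos h]
    · rw [if_neg h, simpleAct_zero i hi, if_neg (by simpa [isMiddle_rev] using h)]
      simp
  · rw [simpleAct_pos i hi, simpleAct_pos i hi]
    ext k; simp

theorem swap_swap_comm {α β : Type*} [DecidableEq α] (f : α → β) (a b c e : α)
    (h1 : a ≠ c) (h2 : a ≠ e) (h3 : b ≠ c) (h4 : b ≠ e) :
    (f ∘ Equiv.swap a b) ∘ Equiv.swap c e = (f ∘ Equiv.swap c e) ∘ Equiv.swap a b := by
  ext k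
  simp only [Function.comp_apply, Equiv.swap_apply_def]
  grind

theorem simpleAct_comm {d r m : ℕ} (i j : Fin d) (h : i.1 + 1 < j.1) (f : LetterWord d r m) :
    simpleAct i (simpleAct j f) = simpleAct j (simpleAct i f) := by
  have hj : j.1 ≠ 0 := by omega
  have hij : i ≠ j := by intro e; subst e; omega
  have hpj : i ≠ prev j := by intro e; rw [e] at h; simp [prev] at h; omega
  by_cases hi : i.1 = 0
  · rw [simpleAct_pos j hj, simpleAct_zero i hi, simpleAct_zero i hi]
    have e : (f ∘ Equiv.swap (prev j) j) i = f i := by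
      simp [Equiv.swap_apply_of_ne_of_ne hpj hij]
    rw [e]
    split_ifs
    · rw [simpleAct_pos j hj]
    · rw [simpleAct_pos j hj]
      ext k
      simp only [Function.comp_apply, Function.update_apply, Equiv.swap_apply_def]
      grind
  · rw [simpleAct_pos j hj, simpleAct_pos i hi, simpleAct_pos i hi, simpleAct_pos j hj]
    apply swap_swap_comm
    · intro e; simp [prev, Fin.ext_iff] at e; omega
    · intro e; simp [prev, Fin.ext_iff] at e; omega
    · intro e; simp [prev, Fin.ext_iff] at e; omega
    · exact hij.symm

/-- The word with entries `x`, `y`, `z` at the positions `a`, `b`, `c` and those of `f` elsewhere. -/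
def patch₃ {d r m : ℕ} (f : LetterWord d r m) (a b c : Fin d) (x y z : Letter r m) :
    LetterWord d r m :=
  fun k => if k = a then x else if k = b then y else if k = c then z else f k

/-- The word with entries `x`, `y` at the positions `a`, `b` and those of `f` elsewhere. -/
def patch₂ {d r m : ℕ} (f : LetterWord d r m) (a b : Fin d) (x y : Letter r m) :
    LetterWord d r m :=
  fun k => if k = a then x else if k = b then y else f k

theorem patch₃_self {d r m : ℕ} (f : LetterWord d r m) (a b c : Fin d) :
    patch₃ f a b c (f a) (f b) (f c) = f := by
  ext k; unfold patch₃; grind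

theorem patch₂_self {d r m : ℕ} (f : LetterWord d r m) (a b : Fin d) :
    patch₂ f a b (f a) (f b) = f := by
  ext k; unfold patch₂; grind

theorem patch₃_swap_left {d r m : ℕ} (f : LetterWord d r m) (a b c : Fin d)
    (hab : a ≠ b) (x y z : Letter r m) :
    patch₃ f a b c x y z ∘ Equiv.swap a b = patch₃ f a b c y x z := by
  ext k
  simp only [patch₃, Function.comp_apply, Equiv.swap_apply_def]
  grind

theorem patch₃_swap_right {d r m : ℕ} (f : LetterWord d r m) (a b c : Fin d)
    (hab : a ≠ b) (hac : a ≠ c) (hbc : b ≠ c) (x y z : Letter r m) :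
    patch₃ f a b c x y z ∘ Equiv.swap b c = patch₃ f a b c x z y := by
  ext k
  simp only [patch₃, Function.comp_apply, Equiv.swap_apply_def]
  grind

theorem patch₂_swap {d r m : ℕ} (f : LetterWord d r m) (a b : Fin d)
    (hab : a ≠ b) (x y : Letter r m) :
    patch₂ f a b x y ∘ Equiv.swap a b = patch₂ f a b y x := by
  ext k
  simp only [patch₂, Function.comp_apply, Equiv.swap_apply_def]
  grind

theorem patch₂_update {d r m : ℕ} (f : LetterWord d r m) (a b : Fin d) (x y z : Letter r m) :
    Function.update (patch₂ f a b x y) a z = patch₂ f a b z y := by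
  ext k
  simp only [patch₂, Function.update_apply]
  grind

theorem simpleAct_braid₃ {d r m : ℕ} (i j : Fin d) (hi : i.1 ≠ 0) (h : i.1 + 1 = j.1)
    (f : LetterWord d r m) :
    simpleAct i (simpleAct j (simpleAct i f)) = simpleAct j (simpleAct i (simpleAct j f)) := by
  have hp : prev j = i := by ext; simp [prev]; omega
  have h1 : prev i ≠ i := by intro e; simp [prev, Fin.ext_iff] at e; omega
  have h2 : prev i ≠ j := by intro e; simp [prev, Fin.ext_iff] at e; omega
  have h3 : i ≠ j := by intro e; subst e; omega
  rw [← patch₃_self f (prev i) i j]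
  simp only [simpleAct_pos i hi, simpleAct_pos j (by omega), hp,
    patch₃_swap_left f _ _ _ h1, patch₃_swap_right f _ _ _ h1 h2 h3]

theorem simpleAct_patch₂ {d r m : ℕ} (i j : Fin d) (hi : i.1 = 0)
    (f : LetterWord d r m) (x y : Letter r m) :
    simpleAct i (patch₂ f i j x y) =
      if IsMiddle x then patch₂ f i j x y else patch₂ f i j x.rev y := by
  have e : patch₂ f i j x y i = x := by simp [patch₂]
  rw [simpleAct_zero i hi, e, patch₂_update]

theorem simpleAct_braid₄ {d r m : ℕ} (i j : Fin d) (hi : i.1 = 0) (h : j.1 = 1)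
    (f : LetterWord d r m) :
    simpleAct i (simpleAct j (simpleAct i (simpleAct j f))) =
      simpleAct j (simpleAct i (simpleAct j (simpleAct i f))) := by
  have hp : prev j = i := by ext; simp [prev]; omega
  have h3 : i ≠ j := by intro e; subst e; omega
  rw [← patch₂_self f i j]
  have hs : ∀ x y, simpleAct j (patch₂ f i j x y) = patch₂ f i j y x := by
    intro x y
    rw [simpleAct_pos j (by omega), hp, patch₂_swap f i j h3]
  by_cases hx : IsMiddle (f i) <;> by_cases hy : IsMiddle (f j) <;>
    simp [hs, simpleAct_patch₂ i j hi, hx, hy]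

/-- In a monoid with elements satisfying the braid relations of type `B`, involutions satisfy the
Coxeter relations. -/
theorem typeB_isLiftable {d : ℕ} {G : Type*} [Monoid G] (a : Fin d → G)
    (hinv : ∀ i, a i * a i = 1)
    (h2 : ∀ i j : Fin d, i.1 + 1 < j.1 → a i * a j = a j * a i)
    (h3 : ∀ i j : Fin d, i.1 ≠ 0 → i.1 + 1 = j.1 → a i * a j * a i = a j * a i * a j)
    (h4 : ∀ i j : Fin d, i.1 = 0 → j.1 = 1 →
      a i * a j * a i * a j = a j * a i * a j * a i) :
    (typeB d).IsLiftable a := by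
  have key2 : ∀ x y : G, x * x = 1 → y * y = 1 → x * y = y * x → (x * y) ^ 2 = 1 := by
    intro x y hx hy h
    calc (x * y) ^ 2 = (x * y) * (x * y) := pow_two _
      _ = (x * y) * (y * x) := by rw [← h]
      _ = x * (y * y) * x := by simp only [mul_assoc]
      _ = 1 := by rw [hy, mul_one, hx]
  have key3 : ∀ x y : G, x * x = 1 → y * y = 1 → x * y * x = y * x * y → (x * y) ^ 3 = 1 := by
    intro x y hx hy h
    calc (x * y) ^ 3 = (x * y * x) * (y * x * y) := by simp only [pow_succ, pow_zero, one_mul,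
          mul_assoc]
      _ = (x * y * x) * (x * y * x) := by rw [← h]
      _ = x * (y * (x * x) * y) * x := by simp only [mul_assoc]
      _ = 1 := by rw [hx, mul_one, hy, mul_one, hx]
  have key4 : ∀ x y : G, x * x = 1 → y * y = 1 → x * y * x * y = y * x * y * x →
      (x * y) ^ 4 = 1 := by
    intro x y hx hy h
    calc (x * y) ^ 4 = (x * y * x * y) * (x * y * x * y) := by simp only [pow_succ, pow_zero,
          one_mul, mul_assoc]
      _ = (x * y * x * y) * (y * x * y * x) := by rw [← h]
      _ = x * (y * (x * (y * y) * x) * y) * x := by simp only [mul_assoc]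
      _ = 1 := by rw [hy, mul_one, hx, mul_one, hy, mul_one, hx]
  intro i j
  rw [typeB_apply]
  split_ifs with c1 c2 c3
  · rw [c1, hinv, one_pow]
  · rcases c2 with ⟨ci, cj⟩ | ⟨ci, cj⟩
    · exact key4 _ _ (hinv i) (hinv j) (h4 i j ci cj)
    · exact key4 _ _ (hinv i) (hinv j) (h4 j i cj ci).symm
  · rcases c3 with c3 | c3
    · exact key3 _ _ (hinv i) (hinv j) (h3 j i (by omega) c3).symm
    · exact key3 _ _ (hinv i) (hinv j) (h3 i j (by omega) c3)
  · have : i.1 ≠ j.1 := fun e => c1 (Fin.ext e)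
    rcases lt_or_gt_of_ne this with h | h
    · exact key2 _ _ (hinv i) (hinv j) (h2 i j (by omega))
    · exact key2 _ _ (hinv i) (hinv j) (h2 j i (by omega)).symm

/-- The right action of the Weyl group of type `B_d` on words, as a homomorphism into the opposite
of the monoid of self-maps. -/
def wordAct (d r m : ℕ) : (typeB d).Group →* (Function.End (LetterWord d r m))ᵐᵒᵖ :=
  (typeB d).toCoxeterSystem.lift ⟨fun i => op (simpleAct i), typeB_isLiftable _
    (fun i => unop_injective (funext fun f => simpleAct_simpleAct i f))
    (fun i j h => unop_injective (funext fun f => (simpleAct_comm i j h f).symm))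
    (fun i j hi h => unop_injective (funext fun f => simpleAct_braid₃ i j hi h f))
    (fun i j hi h => unop_injective (funext fun f => (simpleAct_braid₄ i j hi h f).symm))⟩

/-- The word `f · σ`. -/
def act {d r m : ℕ} (f : LetterWord d r m) (σ : (typeB d).Group) : LetterWord d r m :=
  (wordAct d r m σ).unop f

theorem act_one {d r m : ℕ} (f : LetterWord d r m) : act f 1 = f := by
  simp [act]; rfl

theorem act_mul {d r m : ℕ} (f : LetterWord d r m) (σ τ : (typeB d).Group) :
    act f (σ * τ) = act (act f σ) τ := by
  simp [act]; rfl

theorem act_simple {d r m : ℕ} (f : LetterWord d r m) (i : Fin d) :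
    act f ((typeB d).toCoxeterSystem.simple i) = simpleAct i f := by
  unfold act wordAct
  rw [CoxeterSystem.lift_apply_simple]
  rfl

/-- The quasi-parabolic subgroup `W_f`: the stabilizer of the word `f`. -/
def stab {d r m : ℕ} (f : LetterWord d r m) : Subgroup (typeB d).Group where
  carrier := {σ | act f σ = f}
  one_mem' := act_one f
  mul_mem' := by
    intro a b ha hb
    change act f (a * b) = f
    rw [act_mul, show act f a = f from ha, show act f b = f from hb]
  inv_mem' := by
    intro a ha
    change act f a⁻¹ = f
    have h := act_mul f a a⁻¹
    rw [mul_inv_cancel, act_one, show act f a = f from ha] at h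
    exact h.symm

/-- The words with `(m-1)/2 ≥ f(1) ≥ f(2) ≥ ⋯ ≥ f(d)`. -/
def IsAntidominant {d r m : ℕ} (f : LetterWord d r m) : Prop :=
  Antitone f ∧ ∀ i, ¬ IsUpper (f i)

set_option linter.unusedSimpArgs false
set_option linter.unusedTactic false
set_option linter.unreachableTactic false
set_option linter.unnecessarySeqFocus false

/-- The Hecke algebra of type `B_d` with parameters `p` (for `H_0`) and `q` (for `H_1, …`). -/
abbrev HeckeB {K : Type*} [CommRing K] (d : ℕ) (p q : Kˣ) : Type _ :=
  HeckeAlgebra K (typeB d) (typeBParam d p q)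

/-- The tensor power `𝕍^{⊗ d}` of the free module `𝕍` with basis `v_a`, `a` a letter. -/
def TensorSpace (K : Type*) [CommRing K] (d r m : ℕ) : Type _ :=
  ⨂[K] _ : Fin d, (Letter r m →₀ K)

instance (K : Type*) [CommRing K] (d r m : ℕ) : AddCommGroup (TensorSpace K d r m) :=
  inferInstanceAs (AddCommGroup (⨂[K] _ : Fin d, (Letter r m →₀ K)))

instance (K : Type*) [CommRing K] (d r m : ℕ) : Module K (TensorSpace K d r m) :=
  inferInstanceAs (Module K (⨂[K] _ : Fin d, (Letter r m →₀ K)))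

/-- The tensor `M_f = v_{f(1)} ⊗ ⋯ ⊗ v_{f(d)}`. -/
def stdTensor (K : Type*) [CommRing K] {d r m : ℕ} (f : LetterWord d r m) : TensorSpace K d r m :=
  PiTensorProduct.tprod K (fun k => Finsupp.single (f k) (1 : K))

/-- The tensors `M_f` form a basis. -/
def stdBasis (K : Type*) [CommRing K] (d r m : ℕ) :
    Module.Basis (LetterWord d r m) K (TensorSpace K d r m) :=
  Basis.piTensorProduct (R := K) (fun _ : Fin d => Finsupp.basisSingleOne (ι := Letter r m))

theorem stdBasis_apply (K : Type*) [CommRing K] {d r m : ℕ} (f : LetterWord d r m) :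
    stdBasis K d r m f = stdTensor K f := by
  refine (Basis.piTensorProduct_apply (R := K)
    (fun _ : Fin d => Finsupp.basisSingleOne (ι := Letter r m)) f).trans ?_
  unfold stdTensor
  simp only [Finsupp.coe_basisSingleOne]

section Action

variable {K : Type*} [CommRing K] {d r m : ℕ} (p q : Kˣ)

/-- The right action of the generator `H_i` on `𝕍^{⊗ d}`, given on the basis `M_f`. -/
def genAct (i : Fin d) : Module.End K (TensorSpace K d r m) :=
  (stdBasis K d r m).constr K fun f =>
    if i.1 = 0 then
      if IsMiddle (f i) then (p : K) • stdTensor K f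
      else if IsUpper (f i) then
        stdTensor K (simpleAct i f) + ((p : K) - ((p⁻¹ : Kˣ) : K)) • stdTensor K f
      else stdTensor K (simpleAct i f)
    else
      if f (prev i) < f i then
        stdTensor K (simpleAct i f) + ((q : K) - ((q⁻¹ : Kˣ) : K)) • stdTensor K f
      else if f i < f (prev i) then stdTensor K (simpleAct i f)
      else (q : K) • stdTensor K f

theorem genAct_zero (i : Fin d) (hi : i.1 = 0) (f : LetterWord d r m) :
    genAct p q i (stdTensor K f) =
      if IsMiddle (f i) then (p : K) • stdTensor K f
      else if IsUpper (f i) then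
        stdTensor K (simpleAct i f) + ((p : K) - ((p⁻¹ : Kˣ) : K)) • stdTensor K f
      else stdTensor K (simpleAct i f) := by
  conv_lhs => rw [← stdBasis_apply, genAct, Module.Basis.constr_basis, if_pos hi]

theorem genAct_pos (i : Fin d) (hi : i.1 ≠ 0) (f : LetterWord d r m) :
    genAct p q i (stdTensor K f) =
      if f (prev i) < f i then
        stdTensor K (simpleAct i f) + ((q : K) - ((q⁻¹ : Kˣ) : K)) • stdTensor K f
      else if f i < f (prev i) then stdTensor K (simpleAct i f)
      else (q : K) • stdTensor K f := by
  conv_lhs => rw [← stdBasis_apply, genAct, Module.Basis.constr_basis, if_neg hi]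

/-- The coefficient `c` in `M_f H_i = M_{f · s_i} + c M_f`. -/
def actCoeff (i : Fin d) (f : LetterWord d r m) : K :=
  if i.1 = 0 then
    if IsMiddle (f i) then (p : K) - 1
    else if IsUpper (f i) then (p : K) - ((p⁻¹ : Kˣ) : K) else 0
  else
    if f (prev i) < f i then (q : K) - ((q⁻¹ : Kˣ) : K)
    else if f i < f (prev i) then 0 else (q : K) - 1

theorem genAct_stdTensor (i : Fin d) (f : LetterWord d r m) :
    genAct p q i (stdTensor K f) =
      stdTensor K (simpleAct i f) + actCoeff p q i f • stdTensor K f := by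
  unfold actCoeff
  by_cases hi : i.1 = 0
  · rw [genAct_zero p q i hi, if_pos hi]
    split_ifs with h1 h2
    · rw [simpleAct_zero i hi, if_pos h1]; module
    · rfl
    · simp
  · rw [genAct_pos p q i hi, if_neg hi]
    split_ifs with h1 h2
    · rfl
    · simp
    · have e : f (prev i) = f i := le_antisymm (not_lt.1 h2) (not_lt.1 h1)
      have : simpleAct i f = f := by
        rw [simpleAct_pos i hi]
        ext k
        simp only [Function.comp_apply, Equiv.swap_apply_def]
        grind
      rw [this]; module

theorem end_ext {F G : Module.End K (TensorSpace K d r m)}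
    (h : ∀ f, F (stdTensor K f) = G (stdTensor K f)) : F = G :=
  (stdBasis K d r m).ext fun f => by rw [stdBasis_apply, h]

theorem genAct_quadratic (i : Fin d) :
    (genAct (r := r) (m := m) p q i + algebraMap K _ (((typeBParam d p q i)⁻¹ : Kˣ) : K)) *
      (genAct p q i - algebraMap K _ (typeBParam d p q i : K)) = 0 := by
  have hp : (p : K) * ((p⁻¹ : Kˣ) : K) = 1 := p.mul_inv
  have hq : (q : K) * ((q⁻¹ : Kˣ) : K) = 1 := q.mul_inv
  refine end_ext fun f => ?_
  simp only [Module.End.mul_apply, LinearMap.sub_apply, LinearMap.add_apply, map_sub,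
    Module.algebraMap_end_apply, LinearMap.zero_apply, map_smul, smul_add, smul_smul]
  unfold typeBParam
  by_cases hi : i.1 = 0
  · simp only [if_pos hi]
    by_cases h1 : IsMiddle (f i)
    · simp only [genAct_zero p q i hi, if_pos h1, map_smul]; module
    · have e1 : (simpleAct i f) i = (f i).rev := by rw [simpleAct_zero i hi]; simp [h1]
      have e2 : ¬ IsMiddle (f i).rev := by rwa [isMiddle_rev]
      have e3 := isUpper_rev (f i) h1
      by_cases h2 : IsUpper (f i)
      · have e4 : ¬ IsUpper (f i).rev := by simp [e3, h2]
        simp only [genAct_zero p q i hi, if_neg h1, if_pos h2, e1, if_neg e2, if_neg e4,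
          simpleAct_simpleAct, map_add, map_smul]
        match_scalars <;> grind
      · have e4 : IsUpper (f i).rev := by simp [e3, h2]
        simp only [genAct_zero p q i hi, if_neg h1, if_neg h2, e1, if_neg e2, if_pos e4,
          simpleAct_simpleAct]
        match_scalars <;> grind
  · simp only [if_neg hi]
    have e1 : (simpleAct i f) i = f (prev i) := by rw [simpleAct_pos i hi]; simp
    have e2 : (simpleAct i f) (prev i) = f i := by rw [simpleAct_pos i hi]; simp
    simp only [genAct_pos p q i hi]
    rcases lt_trichotomy (f (prev i)) (f i) with h | h | h
    · simp only [if_pos h, if_neg (not_lt_of_gt h), map_add, map_smul, genAct_pos p q i hi, e1, e2,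
        simpleAct_simpleAct]
      match_scalars <;> grind
    · simp only [h, lt_irrefl, if_false, map_smul, genAct_pos p q i hi]
      module
    · simp only [if_pos h, if_neg (not_lt_of_gt h), genAct_pos p q i hi, e1, e2,
        simpleAct_simpleAct]
      match_scalars <;> grind

theorem genAct_comm (i j : Fin d) (h : i.1 + 1 < j.1) :
    genAct (r := r) (m := m) p q i * genAct p q j = genAct p q j * genAct p q i := by
  have hj : j.1 ≠ 0 := by omega
  have n1 : i ≠ j := by intro e; subst e; omega
  have n2 : i ≠ prev j := by intro e; simp [prev, Fin.ext_iff] at e; omega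
  have n3 : prev i ≠ j := by intro e; simp [prev, Fin.ext_iff] at e; omega
  have n4 : prev i ≠ prev j := by intro e; simp [prev, Fin.ext_iff] at e; omega
  refine end_ext fun f => ?_
  have c1 : actCoeff p q i (simpleAct j f) = actCoeff p q i f := by
    have e1 : simpleAct j f i = f i := by
      rw [simpleAct_pos j hj]; simp [Equiv.swap_apply_of_ne_of_ne n2 n1]
    have e2 : simpleAct j f (prev i) = f (prev i) := by
      rw [simpleAct_pos j hj]; simp [Equiv.swap_apply_of_ne_of_ne n4 n3]
    simp only [actCoeff, e1, e2]
  have c2 : actCoeff p q j (simpleAct i f) = actCoeff p q j f := by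
    have key : ∀ k, k ≠ i → k ≠ prev i → simpleAct i f k = f k := by
      intro k k1 k2
      by_cases hi : i.1 = 0
      · rw [simpleAct_zero i hi]; split_ifs <;> simp [k1]
      · rw [simpleAct_pos i hi]; simp [Equiv.swap_apply_of_ne_of_ne k2 k1]
    simp only [actCoeff, key j n1.symm n3.symm, key (prev j) n2.symm n4.symm]
  simp only [Module.End.mul_apply, genAct_stdTensor, map_add, map_smul, c1, c2,
    simpleAct_comm i j h]
  module

theorem genAct_braid₃ (i j : Fin d) (hi : i.1 ≠ 0) (h : i.1 + 1 = j.1) :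
    genAct (r := r) (m := m) p q i * genAct p q j * genAct p q i =
      genAct p q j * genAct p q i * genAct p q j := by
  have hq : (q : K) * ((q⁻¹ : Kˣ) : K) = 1 := q.mul_inv
  have hj : j.1 ≠ 0 := by omega
  have hp : prev j = i := by ext; simp [prev]; omega
  have h1 : prev i ≠ i := by intro e; simp [prev, Fin.ext_iff] at e; omega
  have h2 : prev i ≠ j := by intro e; simp [prev, Fin.ext_iff] at e; omega
  have h3 : i ≠ j := by intro e; subst e; omega
  refine end_ext fun f => ?_
  rw [← patch₃_self f (prev i) i j]
  generalize f (prev i) = x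
  generalize f i = y
  generalize f j = z
  have e1 : ∀ x y z, patch₃ f (prev i) i j x y z (prev i) = x := by intros; simp [patch₃]
  have e2 : ∀ x y z, patch₃ f (prev i) i j x y z i = y := by intros; simp [patch₃, h1.symm]
  have e3 : ∀ x y z, patch₃ f (prev i) i j x y z j = z := by
    intros; simp [patch₃, h2.symm, h3.symm]
  have T1 := fun x y z => genAct_pos (K := K) p q i hi (patch₃ f (prev i) i j x y z)
  have T2 := fun x y z => genAct_pos (K := K) p q j hj (patch₃ f (prev i) i j x y z)
  simp only [e1, e2, e3, hp, simpleAct_pos i hi, simpleAct_pos j hj,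
    patch₃_swap_left f _ _ _ h1, patch₃_swap_right f _ _ _ h1 h2 h3] at T1 T2
  simp only [Module.End.mul_apply]
  rcases lt_trichotomy x y with hxy | hxy | hxy <;>
  rcases lt_trichotomy y z with hyz | hyz | hyz <;>
  rcases lt_trichotomy x z with hxz | hxz | hxz <;>
  (subst_vars
   simp only [map_add, map_smul, if_true, if_false, lt_irrefl, *, not_lt_of_gt, smul_add, smul_smul]
   try (match_scalars <;> grind))

theorem genAct_braid₄ (i j : Fin d) (hi : i.1 = 0) (h : j.1 = 1) :
    genAct (r := r) (m := m) p q i * genAct p q j * genAct p q i * genAct p q j =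
      genAct p q j * genAct p q i * genAct p q j * genAct p q i := by
  have hpp : (p : K) * ((p⁻¹ : Kˣ) : K) = 1 := p.mul_inv
  have hqq : (q : K) * ((q⁻¹ : Kˣ) : K) = 1 := q.mul_inv
  have hj : j.1 ≠ 0 := by omega
  have hp : prev j = i := by ext; simp [prev]; omega
  have h3 : i ≠ j := by intro e; subst e; omega
  refine end_ext fun f => ?_
  rw [← patch₂_self f i j]
  generalize f i = x
  generalize f j = y
  have e1 : ∀ x y, patch₂ f i j x y i = x := by intros; simp [patch₂]
  have e2 : ∀ x y, patch₂ f i j x y j = y := by intros; simp [patch₂, h3.symm]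
  have T1 := fun x y => genAct_zero (K := K) p q i hi (patch₂ f i j x y)
  have T2 := fun x y => genAct_pos (K := K) p q j hj (patch₂ f i j x y)
  simp only [e1, e2, hp, simpleAct_patch₂ i j hi, simpleAct_pos j hj,
    patch₂_swap f _ _ h3] at T1 T2
  have hvx : x.rev.1 = 2 * r + m - (x.1 + 1) := Fin.val_rev x
  have hvy : y.rev.1 = 2 * r + m - (y.1 + 1) := Fin.val_rev y
  have hx2 := x.2
  have hy2 := y.2
  have L1 : y < x.rev ↔ x < y.rev := by simp only [Fin.lt_def, hvx, hvy]; omega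
  have L2 : x.rev < y ↔ y.rev < x := by simp only [Fin.lt_def, hvx, hvy]; omega
  have L3 : x.rev < y.rev ↔ y < x := Fin.rev_lt_rev
  have L4 : y.rev < x.rev ↔ x < y := Fin.rev_lt_rev
  simp only [Module.End.mul_apply]
  by_cases hmx : IsMiddle x <;> by_cases hmy : IsMiddle y
  · rcases lt_trichotomy x y with hxy | hxy | hxy
    · simp only [T1, T2, hmx, hmy, hxy, not_lt_of_gt hxy, if_true, if_false, map_add, map_smul,
        smul_add, smul_smul]
      try (match_scalars <;> grind)
    · subst hxy
      simp only [T1, T2, hmx, lt_irrefl, if_true, if_false, map_smul, smul_smul]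
      try (match_scalars <;> grind)
    · simp only [T1, T2, hmx, hmy, hxy, not_lt_of_gt hxy, if_true, if_false, map_add, map_smul,
        smul_add, smul_smul]
      try (match_scalars <;> grind)
  · have hmy' : ¬ IsMiddle y.rev := by rwa [isMiddle_rev]
    have huy' := isUpper_rev y hmy
    by_cases huy : IsUpper y
    · have k1 : x < y := by unfold IsMiddle at hmx; unfold IsUpper at huy; rw [Fin.lt_def]; omega
      have k2 : y.rev < x := by
        unfold IsMiddle at hmx; unfold IsUpper at huy; rw [Fin.lt_def]; omega
      simp only [T1, T2, hmx, hmy, hmy', huy, huy', k1, k2, not_lt_of_gt k1, not_lt_of_gt k2,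
        if_true, if_false, map_add, map_smul, smul_add, smul_smul, Fin.rev_rev, not_true]
      try (match_scalars <;> grind)
    · have k1 : y < x := by
        unfold IsMiddle at hmx hmy; unfold IsUpper at huy; rw [Fin.lt_def]; omega
      have k2 : x < y.rev := by
        unfold IsMiddle at hmx hmy; unfold IsUpper at huy; rw [Fin.lt_def]; omega
      simp only [T1, T2, hmx, hmy, hmy', huy, huy', k1, k2, not_lt_of_gt k1, not_lt_of_gt k2,
        if_true, if_false, map_add, map_smul, smul_add, smul_smul, Fin.rev_rev, not_false_eq_true]
      try (match_scalars <;> grind)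
  · have hmx' : ¬ IsMiddle x.rev := by rwa [isMiddle_rev]
    have hux' := isUpper_rev x hmx
    by_cases hux : IsUpper x
    · have k1 : y < x := by unfold IsMiddle at hmy; unfold IsUpper at hux; rw [Fin.lt_def]; omega
      have k2 : x.rev < y := by
        unfold IsMiddle at hmy; unfold IsUpper at hux; rw [Fin.lt_def]; omega
      simp only [T1, T2, hmx, hmy, hmx', hux, hux', k1, k2, not_lt_of_gt k1, not_lt_of_gt k2,
        if_true, if_false, map_add, map_smul, smul_add, smul_smul, Fin.rev_rev, not_true]
      try (match_scalars <;> grind)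
    · have k1 : x < y := by
        unfold IsMiddle at hmx hmy; unfold IsUpper at hux; rw [Fin.lt_def]; omega
      have k2 : y < x.rev := by
        unfold IsMiddle at hmx hmy; unfold IsUpper at hux; rw [Fin.lt_def]; omega
      simp only [T1, T2, hmx, hmy, hmx', hux, hux', k1, k2, not_lt_of_gt k1, not_lt_of_gt k2,
        if_true, if_false, map_add, map_smul, smul_add, smul_smul, Fin.rev_rev, not_false_eq_true]
      try (match_scalars <;> grind)
  · have hmy' : ¬ IsMiddle y.rev := by rwa [isMiddle_rev]
    have huy' := isUpper_rev y hmy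
    have hmx' : ¬ IsMiddle x.rev := by rwa [isMiddle_rev]
    have hux' := isUpper_rev x hmx
    by_cases hux : IsUpper x <;> by_cases huy : IsUpper y
    all_goals
      rcases lt_trichotomy x y with hxy | hxy | hxy
    all_goals
      rcases lt_trichotomy x y.rev with hxz | hxz | hxz
    all_goals
      first
      | (exfalso
         clear T1 T2 hmx' hmy' hux' huy' L1 L2 L3 L4
         simp only [IsMiddle, IsUpper, Fin.lt_def, Fin.ext_iff, not_and, not_lt, not_le] at *
         omega)
      | skip
    all_goals
      try subst hxy
    all_goals
      try subst hxz
    all_goals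
      simp only [T1, T2, Fin.rev_rev, Fin.rev_lt_rev, if_true, if_false, map_add, map_smul,
        smul_add, smul_smul, lt_irrefl, not_lt_of_gt, not_true, not_false_eq_true, *]
      try (match_scalars <;> grind)

/-- The braid relations of type `B_d` in their usual form imply the uniform ones. -/
theorem typeB_braid {A : Type*} [Monoid A] (a : Fin d → A)
    (h2 : ∀ i j : Fin d, i.1 + 1 < j.1 → a i * a j = a j * a i)
    (h3 : ∀ i j : Fin d, i.1 ≠ 0 → i.1 + 1 = j.1 → a i * a j * a i = a j * a i * a j)
    (h4 : ∀ i j : Fin d, i.1 = 0 → j.1 = 1 →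
      a i * a j * a i * a j = a j * a i * a j * a i) (s t : Fin d) :
    ((CoxeterSystem.braidWord (typeB d) s t).map a).prod =
      ((CoxeterSystem.braidWord (typeB d) t s).map a).prod := by
  unfold CoxeterSystem.braidWord
  rw [(typeB d).symmetric t s, typeB_apply]
  split_ifs with c1 c2 c3
  · rw [c1]
  · simp only [CoxeterSystem.alternatingWord, List.concat_eq_append, List.nil_append,
      List.cons_append, List.map_cons, List.map_nil, List.prod_cons, List.prod_nil, mul_one]
    simp only [mul_assoc] at h4
    rcases c2 with ⟨cs, ct⟩ | ⟨cs, ct⟩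
    · exact h4 s t cs ct
    · exact (h4 t s ct cs).symm
  · simp only [CoxeterSystem.alternatingWord, List.concat_eq_append, List.nil_append,
      List.cons_append, List.map_cons, List.map_nil, List.prod_cons, List.prod_nil, mul_one]
    simp only [mul_assoc] at h3
    rcases c3 with c3 | c3
    · exact h3 t s (by omega) c3
    · exact (h3 s t (by omega) c3).symm
  · simp only [CoxeterSystem.alternatingWord, List.concat_eq_append, List.nil_append,
      List.cons_append, List.map_cons, List.map_nil, List.prod_cons, List.prod_nil, mul_one]
    have : s.1 ≠ t.1 := fun e => c1 (Fin.ext e)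
    rcases lt_or_gt_of_ne this with h | h
    · exact h2 s t (by omega)
    · exact (h2 t s (by omega)).symm

theorem op_genAct_quadratic (i : Fin d) :
    (op (genAct (r := r) (m := m) p q i) - algebraMap K _ (typeBParam d p q i : K)) *
      (op (genAct p q i) + algebraMap K _ (((typeBParam d p q i)⁻¹ : Kˣ) : K)) = 0 := by
  apply unop_injective
  rw [unop_mul, unop_add, unop_sub, unop_op, MulOpposite.algebraMap_apply,
    MulOpposite.algebraMap_apply, unop_op, unop_op, unop_zero]
  exact genAct_quadratic p q i

theorem op_genAct_braid (s t : Fin d) :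
    ((CoxeterSystem.braidWord (typeB d) s t).map
        (fun i => op (genAct (r := r) (m := m) p q i))).prod =
      ((CoxeterSystem.braidWord (typeB d) t s).map (fun i => op (genAct p q i))).prod := by
  apply typeB_braid
  · intro i j h
    rw [← op_mul, ← op_mul, genAct_comm p q i j h]
  · intro i j hi h
    rw [← op_mul, ← op_mul, ← op_mul, ← op_mul, ← mul_assoc, ← mul_assoc,
      genAct_braid₃ p q i j hi h]
  · intro i j hi h
    rw [← op_mul, ← op_mul, ← op_mul, ← op_mul, ← op_mul, ← op_mul, ← mul_assoc, ← mul_assoc,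
      ← mul_assoc, ← mul_assoc, genAct_braid₄ p q i j hi h]

/-- The right action of the Hecke algebra of type `B_d` on `𝕍^{⊗ d}`, as an algebra map into the
opposite of the endomorphism algebra. -/
def tensorRep (r m : ℕ) : HeckeB d p q →ₐ[K] (Module.End K (TensorSpace K d r m))ᵐᵒᵖ :=
  HeckeAlgebra.lift (typeB d) (typeBParam d p q) (fun i => op (genAct p q i))
    (op_genAct_quadratic p q) (fun s t _ => op_genAct_braid p q s t)

variable {p q}

/-- `𝕍^{⊗ d}` as a right module over the Hecke algebra of type `B_d`. -/
instance : Module (HeckeB d p q)ᵐᵒᵖ (TensorSpace K d r m) where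
  smul h v := (tensorRep p q r m h.unop).unop v
  one_smul v := by
    change (tensorRep p q r m 1).unop v = v
    rw [map_one]; rfl
  mul_smul a b v := by
    change (tensorRep p q r m (b.unop * a.unop)).unop v = _
    rw [map_mul]; rfl
  smul_zero a := map_zero _
  smul_add a := map_add _
  add_smul a b v := by
    change (tensorRep p q r m (a.unop + b.unop)).unop v = _
    rw [map_add]; rfl
  zero_smul v := by
    change (tensorRep p q r m 0).unop v = 0
    rw [map_zero]; rfl

theorem op_gen_smul (i : Fin d) (v : TensorSpace K d r m) :
    op (HeckeAlgebra.gen (typeB d) (typeBParam d p q) i) • v = genAct p q i v := by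
  have h : tensorRep p q r m (HeckeAlgebra.gen (typeB d) (typeBParam d p q) i) =
      op (genAct p q i) := HeckeAlgebra.lift_gen _ _ _ _ _ i
  change (tensorRep p q r m (HeckeAlgebra.gen (typeB d) (typeBParam d p q) i)).unop v = _
  rw [h, unop_op]

instance : IsScalarTower K (HeckeB d p q)ᵐᵒᵖ (TensorSpace K d r m) where
  smul_assoc c h v := by
    change (tensorRep p q r m (c • h.unop)).unop v = c • (tensorRep p q r m h.unop).unop v
    rw [map_smul]; rfl

variable (p q)

/-- The quasi-permutation module `𝕄_f = M_f ℋ_{B_d}`, the cyclic submodule of `𝕍^{⊗ d}`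
generated by `M_f`. -/
abbrev QuasiPerm (f : LetterWord d r m) : Submodule (HeckeB d p q)ᵐᵒᵖ (TensorSpace K d r m) :=
  Submodule.span (HeckeB d p q)ᵐᵒᵖ {stdTensor K f}

theorem stdTensor_mem (f : LetterWord d r m) (σ : (typeB d).Group) :
    stdTensor K (act f σ) ∈ QuasiPerm p q f := by
  induction σ using (typeB d).toCoxeterSystem.simple_induction_right with
  | one => rw [act_one]; exact Submodule.subset_span rfl
  | mul_simple_right σ i ih =>
    rw [act_mul, act_simple]
    have h := genAct_stdTensor (K := K) p q i (act f σ)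
    rw [← op_gen_smul] at h
    rw [← sub_eq_iff_eq_add] at h
    rw [← h]
    refine Submodule.sub_mem _ (Submodule.smul_mem _ _ ih) ?_
    exact Submodule.smul_of_tower_mem _ _ ih

/-- The standard element `M^f_σ = M_{f · σ}` of `𝕄_f`. -/
def stdElt (f : LetterWord d r m) (σ : (typeB d).Group) : QuasiPerm (K := K) p q f :=
  ⟨stdTensor K (act f σ), stdTensor_mem p q f σ⟩

end Action

end TypeB

/-! ### The induced quasi-permutation module -/

section InducedQuasiPerm

variable {K B W : Type*} [CommRing K] [Group W] {M : CoxeterMatrix B} (cs : CoxeterSystem M W)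
  {d r m : ℕ} (j : Fin d → B) (hj : ∀ a b, M (j a) (j b) = typeB d a b)

/-- `ᶠW_d`: the minimal length right coset representatives of `W_f` in `W_d`. -/
def repsInB (f : LetterWord d r m) : Set (typeB d).Group :=
  minReps (typeB d).toCoxeterSystem (stab f)

/-- `ᵈW`: the minimal length right coset representatives of the parabolic subgroup `W_d` in `W`. -/
def repsOfB : Set W := minReps cs (parabolicHom cs j hj).range

/-- `ᶠW`: the minimal length right coset representatives of `W_f` in `W`. -/
def repsInW (f : LetterWord d r m) : Set W := minReps cs ((stab f).map (parabolicHom cs j hj))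

variable {j} {p q : Kˣ} {qs : B → Kˣ} (hpq : ∀ a, qs (j a) = typeBParam d p q a)

/-- The induced right module `𝓜 = 𝕄_f ⊗ ℋ`, the tensor product being over the Hecke algebra of
type `B_d`. -/
abbrev InducedQuasiPerm (f : LetterWord d r m) : Type _ :=
  InducedModule (HeckeAlgebra.parabolicMap (K := K) j hj hpq) (QuasiPerm p q f)

/-- The element `M^f_σ ⊗ H_x` of `𝓜`. -/
def stdInduced (f : LetterWord d r m) (σ : (typeB d).Group) (x : W) :
    InducedQuasiPerm hj hpq f :=
  indTmul _ (stdElt p q f σ) (HeckeAlgebra.basisElt cs qs x)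

end InducedQuasiPerm

end QuasiParabolic

end

/-!
Three facts about Coxeter groups carry the proof, all consequences of the strong exchange condition
(`mem_rightInvSeq_of_length_lt`, `length_mul_mul_lt_iff`).

* Matsumoto's theorem (`prod_map_eq_of_isReduced`), which needs that the order of `s t` really is the
  entry of the Coxeter matrix (`simple_mul_simple_pow_ne_one`, from the geometric representation).
  It makes `H_w` well defined. Being stated for words in a full subdiagram, it also shows that the
  Coxeter group of the subdiagram embeds into `W` with the same lengths (`length_parabolicHom`).
* Lengths add in the factorization `w = y x` with `y` in the standard parabolic subgroup and `x`
  minimal in its coset (`length_parabolicHom_mul`). This gives the bijection `(σ, x) ↦ σ x`.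
* Deodhar's lemma (`mul_simple_mem_minReps_or`): for such an `x` and a generator `s`, either `x s` is
  again minimal in its coset, or `x s = s_i x` for some `i`.

The elements `H_w` form a basis of the Hecke algebra: left and right multiplications commute on the
free module over `W`, so that the left multiplications satisfy the braid relations as soon as they
do on the unit. Hence the Hecke algebra is free over the parabolic one with basis `(H_x)`, and the
induced module is a direct sum of copies of `𝕄_f` (`inducedEquiv`).

It remains to understand `𝕄_f`. Its `K`-basis is the orbit of `f`, and the formulas for the action
of `H_i` are governed by whether `s_i` lowers, raises or fixes a word. Since two different
generators that both lower a word generate a dihedral group that acts freely on it, lowering is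
confluent (`exists_confluence_of_lt`); every word of the orbit can be lowered to `f`, and all ways to
do so multiply up to the same element `σ`, which is therefore the unique shortest element with the
given `f · σ` (`DescPath.unique`, `mem_repsInB_iff`). The three cases of the action on `M_{f·σ}` thus
are the three cases `σ s_i` shorter, longer, or not a minimal representative. Together with
Deodhar's lemma this gives the action on the induced module (`op_gen_smul_stdInducedBasis`).
-/

namespace QuasiParabolic

/-! ### The inversion cocycle and the exchange condition -/

section Exchange

variable {B W : Type*} [Group W] {M : CoxeterMatrix B} (cs : CoxeterSystem M W)

open Classical in
/-- The action of the simple reflection `s_i` on pairs (element of `W`, sign), given by conjugation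
on the first component and changing the sign exactly at `s_i`. -/
noncomputable def signStep (i : B) : Function.End (W × ZMod 2) :=
  fun z => (cs.simple i * z.1 * cs.simple i, z.2 + if z.1 = cs.simple i then 1 else 0)

open Classical in
/-- The alternating product of `2 n` steps changes the sign once for each of the `2 n` reflections
`(s_i s_k)⁻ˡ s_k` that the first component equals. For `n = M i k` each of these reflections is
listed twice, whence the relation `(s_i s_k) ^ M i k = 1` holds for the action. -/
theorem signStep_mul_pow (i k : B) (n : ℕ) (z : W × ZMod 2) :
    ((signStep cs i * signStep cs k) ^ n : Function.End (W × ZMod 2)) z =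
      ((cs.simple i * cs.simple k) ^ n * z.1 * ((cs.simple i * cs.simple k) ^ n)⁻¹,
        z.2 + ∑ l ∈ Finset.range (2 * n),
          if z.1 = ((cs.simple i * cs.simple k)⁻¹) ^ l * cs.simple k then 1 else 0) := by
  induction n with
  | zero => simp; rfl
  | succ n ih =>
    rw [pow_succ']
    change signStep cs i (signStep cs k (((signStep cs i * signStep cs k) ^ n :
      Function.End (W × ZMod 2)) z)) = _
    rw [ih]
    set c := cs.simple i * cs.simple k with hc
    have hkk := cs.simple_mul_simple_self k
    have hii := cs.simple_mul_simple_self i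
    have hcinv : c⁻¹ = cs.simple k * cs.simple i := by simp [hc]
    have hkc : ∀ n : ℕ, cs.simple k * c ^ n = (c⁻¹) ^ n * cs.simple k := by
      intro n
      induction n with
      | zero => simp
      | succ n ihn =>
        rw [pow_succ, ← mul_assoc, ihn, pow_succ, hcinv, hc]
        simp [mul_assoc]
    have e1 : (c ^ n * z.1 * (c ^ n)⁻¹ = cs.simple k) ↔
        z.1 = (c⁻¹) ^ (2 * n) * cs.simple k := by
      rw [mul_inv_eq_iff_eq_mul, hkc, ← eq_inv_mul_iff_mul_eq, ← mul_assoc, ← inv_pow, ← pow_add,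
        two_mul]
    have e2 : (cs.simple k * (c ^ n * z.1 * (c ^ n)⁻¹) * cs.simple k = cs.simple i) ↔
        z.1 = (c⁻¹) ^ (2 * n + 1) * cs.simple k := by
      have : cs.simple k * (c ^ n * z.1 * (c ^ n)⁻¹) * cs.simple k = cs.simple i ↔
          c ^ n * z.1 * (c ^ n)⁻¹ = c⁻¹ * cs.simple k := by
        rw [hcinv]
        constructor
        · intro h; rw [← h]; simp [mul_assoc]
        · intro h; rw [h]; simp [mul_assoc]
      rw [this, mul_inv_eq_iff_eq_mul, mul_assoc, hkc, ← eq_inv_mul_iff_mul_eq, ← inv_pow,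
        ← mul_assoc, ← mul_assoc, ← pow_succ, ← pow_add]
      rw [show n + 1 + n = 2 * n + 1 by ring]
    rw [show 2 * (n + 1) = 2 * n + 1 + 1 by ring, Finset.sum_range_succ, Finset.sum_range_succ]
    unfold signStep
    ext
    · simp only [pow_succ', mul_inv_rev, hc]
      simp [mul_assoc]
    · simp only [e1, e2]
      ring

theorem signStep_isLiftable : M.IsLiftable (signStep cs) := by
  classical
  intro i k
  funext z
  have hc := cs.simple_mul_simple_pow i k
  refine (signStep_mul_pow cs i k (M i k) z).trans ?_
  set c := cs.simple i * cs.simple k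
  have hp : (c⁻¹) ^ M i k = 1 := by rw [inv_pow, hc, inv_one]
  rw [hc, two_mul, Finset.sum_range_add]
  have : ∀ x, (c⁻¹) ^ (M i k + x) = (c⁻¹) ^ x := fun x => by rw [pow_add, hp, one_mul]
  simp only [this, CharTwo.add_self_eq_zero, one_mul, inv_one, mul_one, add_zero]
  rfl

/-- The parity of the number of times that a reflection `t` occurs in the right inversion sequence
of a word for `w`. It does not depend on the word, being read off from an action of `W`. -/
noncomputable def invParity (w t : W) : ZMod 2 :=
  (cs.lift ⟨signStep cs, signStep_isLiftable cs⟩ w (t, 0)).2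

theorem signAction_apply (w : W) (z : W × ZMod 2) :
    cs.lift ⟨signStep cs, signStep_isLiftable cs⟩ w z =
      (w * z.1 * w⁻¹, z.2 + invParity cs w z.1) := by
  induction w using cs.simple_induction_left generalizing z with
  | one =>
    simp only [invParity, map_one, inv_one, one_mul, mul_one]
    exact Prod.ext rfl (add_zero _).symm
  | mul_simple_left w i ih =>
    have key : ∀ z, cs.lift ⟨signStep cs, signStep_isLiftable cs⟩ (cs.simple i * w) z =
        signStep cs i (w * z.1 * w⁻¹, z.2 + invParity cs w z.1) := by
      intro z
      rw [map_mul, CoxeterSystem.lift_apply_simple, ← ih]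
      rfl
    rw [invParity, key, key]
    unfold signStep
    ext
    · simp [mul_assoc]
    · simp [add_assoc]

@[simp] theorem invParity_one (t : W) : invParity cs 1 t = 0 := by
  simp [invParity]; rfl

/-- The cocycle identity. -/
theorem invParity_mul (w v t : W) :
    invParity cs (w * v) t = invParity cs v t + invParity cs w (v * t * v⁻¹) := by
  have h : cs.lift ⟨signStep cs, signStep_isLiftable cs⟩ (w * v) (t, 0) =
      cs.lift ⟨signStep cs, signStep_isLiftable cs⟩ w
        (cs.lift ⟨signStep cs, signStep_isLiftable cs⟩ v (t, 0)) := by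
    rw [map_mul]; rfl
  rw [invParity, h, signAction_apply, signAction_apply]
  simp

open Classical in
theorem invParity_simple (i : B) (t : W) :
    invParity cs (cs.simple i) t = if t = cs.simple i then 1 else 0 := by
  rw [invParity, CoxeterSystem.lift_apply_simple]
  simp [signStep]

theorem mem_rightInvSeq_of_invParity_ne_zero {ω : List B} {t : W}
    (h : invParity cs (cs.wordProd ω) t ≠ 0) : t ∈ cs.rightInvSeq ω := by
  classical
  induction ω with
  | nil => simp at h
  | cons i ω ih =>
    rw [cs.wordProd_cons, invParity_mul, invParity_simple] at h
    rw [CoxeterSystem.rightInvSeq, List.mem_cons]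
    by_cases h' : invParity cs (cs.wordProd ω) t = 0
    · left
      by_contra hne
      rw [h', if_neg, add_zero] at h
      · exact h rfl
      · intro e
        apply hne
        rw [← e]
        group
    · exact Or.inr (ih h')

theorem invParity_self {t : W} (ht : cs.IsReflection t) : invParity cs t t = 1 := by
  classical
  obtain ⟨v, i, rfl⟩ := ht
  have h := invParity_mul cs v v⁻¹ (v * cs.simple i * v⁻¹)
  have e : v⁻¹ * (v * cs.simple i * v⁻¹) * v⁻¹⁻¹ = cs.simple i := by group
  rw [mul_inv_cancel, invParity_one, e] at h
  rw [invParity_mul, e, invParity_mul, invParity_simple, if_pos rfl]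
  simp only [CoxeterSystem.inv_simple, CoxeterSystem.simple_mul_simple_self, one_mul]
  rw [add_comm (1 : ZMod 2), ← add_assoc, ← h, zero_add]

/-- A reflection `t` shortens `w` exactly if the inversion parity of `w` at `t` is odd. -/
theorem invParity_eq_one_iff {w t : W} (ht : cs.IsReflection t) :
    invParity cs w t = 1 ↔ cs.length (w * t) < cs.length w := by
  have key : ∀ w, invParity cs w t ≠ 0 → cs.length (w * t) < cs.length w := by
    intro w h
    obtain ⟨ω, hω, rfl⟩ := cs.exists_isReduced w
    exact (cs.isRightInversion_of_mem_rightInvSeq hω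
      (mem_rightInvSeq_of_invParity_ne_zero cs h)).2
  constructor
  · intro h
    exact key w (by rw [h]; exact one_ne_zero)
  · intro h
    by_contra hne
    have h0 : invParity cs w t = 0 := by
      generalize invParity cs w t = a at hne
      revert a; decide
    have h1 : invParity cs (w * t) t ≠ 0 := by
      rw [invParity_mul, invParity_self cs ht]
      simp [h0]
    have := key _ h1
    rw [mul_assoc, ht.mul_self, mul_one] at this
    omega

/-- The strong exchange condition, for arbitrary words. -/
theorem mem_rightInvSeq_of_length_lt {ω : List B} {t : W} (ht : cs.IsReflection t)
    (h : cs.length (cs.wordProd ω * t) < cs.length (cs.wordProd ω)) : t ∈ cs.rightInvSeq ω := by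
  apply mem_rightInvSeq_of_invParity_ne_zero
  rw [(invParity_eq_one_iff cs ht).2 h]
  exact one_ne_zero

/-- A reflection is a right inversion of `w v` if it is one of `v`, or if its conjugate by `v` is
one of `w`, but not both. -/
theorem length_mul_mul_lt_iff {w v t : W} (ht : cs.IsReflection t) :
    cs.length (w * v * t) < cs.length (w * v) ↔
      ¬ (cs.length (v * t) < cs.length v ↔
        cs.length (w * (v * t * v⁻¹)) < cs.length w) := by
  rw [← invParity_eq_one_iff cs ht, ← invParity_eq_one_iff cs ht,
    ← invParity_eq_one_iff cs (ht.conj v), invParity_mul]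
  generalize invParity cs v t = a
  generalize invParity cs w _ = b
  revert a b; decide

/-- The exchange condition for left multiplication by a simple reflection. -/
theorem exists_eraseIdx_of_isLeftDescent {ω : List B} {i : B}
    (h : cs.IsLeftDescent (cs.wordProd ω) i) :
    ∃ k < ω.length, cs.simple i * cs.wordProd ω = cs.wordProd (ω.eraseIdx k) := by
  have h' : cs.simple i ∈ cs.rightInvSeq ω.reverse := by
    apply mem_rightInvSeq_of_length_lt cs (cs.isReflection_simple i)
    rw [cs.wordProd_reverse, ← cs.inv_simple, ← mul_inv_rev, cs.length_inv, cs.length_inv]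
    exact h
  rw [cs.rightInvSeq_reverse, List.mem_reverse, List.mem_iff_getElem] at h'
  obtain ⟨k, hk, e⟩ := h'
  refine ⟨k, by simpa using hk, ?_⟩
  rw [← cs.getD_leftInvSeq_mul_wordProd, List.getD_eq_getElem _ _ hk, e]

end Exchange

/-! ### The order of a product of two simple reflections -/

section Geometric

open Real Polynomial.Chebyshev

variable {B : Type*} (M : CoxeterMatrix B)

/-- The linear form `2 ⟨α_i, -⟩` on the space with basis `α_k`, where `⟨α_i, α_k⟩` is
`-cos (π / M i k)`. If `M i k = 0`, which stands for an infinite bond, then `π / 0 = 0` and the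
value is `-1`, as it should be. -/
noncomputable def rootForm (i : B) : Module.Dual ℝ (B →₀ ℝ) :=
  Finsupp.linearCombination ℝ fun k => -2 * cos (π / M i k)

theorem rootForm_single (i k : B) :
    rootForm M i (Finsupp.single k 1) = -2 * cos (π / M i k) := by
  simp [rootForm]

theorem rootForm_self (i : B) : rootForm M i (Finsupp.single i 1) = 2 := by
  simp [rootForm_single]

/-- The reflection `z ↦ z - 2 ⟨α_i, z⟩ α_i`. -/
noncomputable def rootReflection (i : B) : (B →₀ ℝ) ≃ₗ[ℝ] (B →₀ ℝ) :=
  Module.reflection (rootForm_self M i)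

/-- The two coefficients in `Module.reflection_mul_reflection_pow_apply` vanish for a rotation by
`2 π / m`. The smaller values of `m` are excluded because the sine of that angle must not be `0`. -/
theorem S_eval_mul_add_eq_zero (m : ℕ) (hm : 3 ≤ m) :
    (((S ℝ (((m : ℤ) - 2) / 2)).eval (2 * cos (2 * π / m)) *
        ((S ℝ (((m : ℤ) - 1) / 2)).eval (2 * cos (2 * π / m)) +
          (S ℝ (((m : ℤ) - 3) / 2)).eval (2 * cos (2 * π / m)))) = 0) ∧
    (((S ℝ (((m : ℤ) - 1) / 2)).eval (2 * cos (2 * π / m)) *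
        ((S ℝ ((m : ℤ) / 2)).eval (2 * cos (2 * π / m)) +
          (S ℝ (((m : ℤ) - 2) / 2)).eval (2 * cos (2 * π / m)))) = 0) := by
  set θ := 2 * π / m with hθ
  have hm0 : (0 : ℝ) < m := by positivity
  have hmθ : m * θ = 2 * π := by rw [hθ]; field_simp
  have hsin : sin θ ≠ 0 := by
    apply ne_of_gt
    apply sin_pos_of_pos_of_lt_pi
    · positivity
    · rw [hθ, div_lt_iff₀ hm0]
      have : (3 : ℝ) ≤ m := by exact_mod_cast hm
      nlinarith [pi_pos]
  obtain ⟨k, rfl | rfl⟩ : ∃ k, m = 2 * k ∨ m = 2 * k + 1 := ⟨m / 2, by omega⟩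
  · have h0 : (S ℝ ((k : ℤ) - 1)).eval (2 * cos θ) = 0 := by
      have h := S_two_mul_real_cos θ ((k : ℤ) - 1)
      have e : ((((k : ℤ) - 1 : ℤ) : ℝ) + 1) * θ = π := by
        push_cast at hmθ ⊢; linarith
      rw [e, sin_pi] at h
      exact (mul_eq_zero.1 h).resolve_right hsin
    rw [show (((2 * k : ℕ) : ℤ) - 2) / 2 = (k : ℤ) - 1 by omega,
      show (((2 * k : ℕ) : ℤ) - 1) / 2 = (k : ℤ) - 1 by omega, h0]
    simp
  · have h0 : (S ℝ (k : ℤ)).eval (2 * cos θ) + (S ℝ ((k : ℤ) - 1)).eval (2 * cos θ) = 0 := by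
      have h1 := S_two_mul_real_cos θ ((k : ℤ) - 1)
      have h2 := S_two_mul_real_cos θ (k : ℤ)
      have e : (((k : ℤ) : ℝ) + 1) * θ = 2 * π - ((((k : ℤ) - 1 : ℤ) : ℝ) + 1) * θ := by
        push_cast at hmθ ⊢; linarith
      rw [e, sin_two_pi_sub, ← h1] at h2
      have : ((S ℝ (k : ℤ)).eval (2 * cos θ) + (S ℝ ((k : ℤ) - 1)).eval (2 * cos θ)) *
          sin θ = 0 := by
        linarith
      exact (mul_eq_zero.1 this).resolve_right hsin
    rw [show (((2 * k + 1 : ℕ) : ℤ) - 2) / 2 = (k : ℤ) - 1 by omega,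
      show (((2 * k + 1 : ℕ) : ℤ) - 1) / 2 = (k : ℤ) by omega,
      show (((2 * k + 1 : ℕ) : ℤ) - 3) / 2 = (k : ℤ) - 1 by omega,
      show (((2 * k + 1 : ℕ) : ℤ)) / 2 = (k : ℤ) by omega, h0]
    simp

theorem rootForm_mul_rootForm (i k : B) :
    rootForm M i (Finsupp.single k 1) * rootForm M k (Finsupp.single i 1) - 2 =
      2 * cos (2 * π / M i k) := by
  rw [rootForm_single, rootForm_single, M.symmetric k i,
    show 2 * π / (M i k : ℝ) = 2 * (π / M i k) by ring, cos_two_mul]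
  ring

theorem rootReflection_isLiftable : M.IsLiftable (rootReflection M) := by
  intro i k
  ext1 z
  rw [rootReflection, rootReflection,
    Module.reflection_mul_reflection_pow_apply _ _ _ _ _ (rootForm_mul_rootForm M i k).symm]
  rcases Nat.lt_or_ge (M i k) 3 with h | h
  · obtain h | h | h : M i k = 0 ∨ M i k = 1 ∨ M i k = 2 := by omega
    · simp [h]
    · have : i = k := by
        by_contra hne
        exact M.off_diagonal i k hne h
      subst this
      have e1 : (((1 : ℕ) : ℤ) - 2) / 2 = -1 := by norm_num
      have e2 : (((1 : ℕ) : ℤ) - 1) / 2 = 0 := by norm_num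
      have e3 : ((1 : ℕ) : ℤ) / 2 = 0 := by norm_num
      rw [h, e1, e2, e3, S_neg_one, S_zero, rootForm_self]
      change _ = z
      simp only [Polynomial.eval_zero, Polynomial.eval_one]
      module
    · have hik : rootForm M i (Finsupp.single k 1) = 0 := by simp [rootForm_single, h]
      have hki : rootForm M k (Finsupp.single i 1) = 0 := by
        simp [rootForm_single, M.symmetric k i, h]
      simp [h, hik, hki]
      module
  · obtain ⟨h1, h2⟩ := S_eval_mul_add_eq_zero (M i k) h
    rw [h1, h2]
    simp

theorem rootReflection_mul_pow_ne_one {i k : B} (hik : i ≠ k) {n : ℕ} (hn : 0 < n)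
    (h : M i k = 0 ∨ n < M i k) : (rootReflection M i * rootReflection M k) ^ n ≠ 1 := by
  intro e
  have e1 := Module.reflection_mul_reflection_pow_apply_self (rootForm_self M i)
    (rootForm_self M k) n _ (rootForm_mul_rootForm M i k).symm
  change ((rootReflection M i * rootReflection M k) ^ n) (Finsupp.single i 1) = _ at e1
  rw [e] at e1
  have ei := DFunLike.congr_fun e1 i
  have ek := DFunLike.congr_fun e1 k
  simp [hik, hik.symm, rootForm_single, M.symmetric k i] at ei ek
  have hM1 : M i k ≠ 1 := M.off_diagonal i k hik
  rcases Nat.lt_or_ge (M i k) 3 with h3 | h3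
  · obtain h' | h' : M i k = 0 ∨ M i k = 2 := by omega
    · simp [h'] at ek
      omega
    · obtain rfl : n = 1 := by omega
      simp [h'] at ei
  · have hm0 : (0 : ℝ) < M i k := by positivity
    have hm3 : (3 : ℝ) ≤ M i k := by exact_mod_cast h3
    set θ := 2 * π / M i k with hθ
    have hmθ : M i k * θ = 2 * π := by rw [hθ]; field_simp
    have hθ0 : 0 < θ := by positivity
    have hθπ : θ < π := by
      rw [hθ, div_lt_iff₀ hm0]
      nlinarith [pi_pos]
    have hsin : 0 < sin θ := sin_pos_of_pos_of_lt_pi hθ0 hθπ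
    have hcos : cos (π / M i k) ≠ 0 := by
      apply ne_of_gt
      apply cos_pos_of_mem_Ioo
      have : π / M i k = θ / 2 := by rw [hθ]; ring
      rw [this]
      constructor <;> linarith
    have hS : (S ℝ ((n : ℤ) - 1)).eval (2 * cos θ) = 0 := by tauto
    have h1 := S_two_mul_real_cos θ ((n : ℤ) - 1)
    have h2 := S_two_mul_real_cos θ (n : ℤ)
    have hnm : (n : ℝ) < M i k := by
      have : n < M i k := by omega
      exact_mod_cast this
    rw [hS] at h1 ei
    have hs : sin (n * θ) = 0 := by
      push_cast at h1; simpa using h1.symm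
    -- since `0 < n θ < 2 π`, the angle `n θ` is `π`, and the rotation is not the identity
    have hc : cos (n * θ) = 1 := by
      rw [add_zero] at ei
      rw [← ei, one_mul, Int.cast_natCast, add_mul, one_mul, sin_add, hs, zero_mul, zero_add] at h2
      exact (mul_right_cancel₀ hsin.ne' (by rw [one_mul]; exact h2)).symm
    have hn0 : (0 : ℝ) < n := by exact_mod_cast hn
    have hlt : n * θ < 2 * π := by rw [← hmθ]; exact mul_lt_mul_of_pos_right hnm hθ0
    have := (cos_eq_one_iff_of_lt_of_lt (by linarith [mul_pos hn0 hθ0, pi_pos]) hlt).1 hc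
    exact (mul_pos hn0 hθ0).ne' this

end Geometric

/-- The order of `s_i s_k` is not smaller than the entry of the Coxeter matrix. -/
theorem simple_mul_simple_pow_ne_one {B W : Type*} [Group W] {M : CoxeterMatrix B}
    (cs : CoxeterSystem M W) {i k : B} (hik : i ≠ k) {n : ℕ} (hn : 0 < n)
    (h : M i k = 0 ∨ n < M i k) : (cs.simple i * cs.simple k) ^ n ≠ 1 := by
  intro e
  apply rootReflection_mul_pow_ne_one M hik hn h
  have := congrArg (cs.lift ⟨rootReflection M, rootReflection_isLiftable M⟩) e
  simpa using this

/-! ### Matsumoto's theorem for words in a full subdiagram -/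

section Matsumoto

variable {B W : Type*} [Group W] {M : CoxeterMatrix B} (cs : CoxeterSystem M W)

open CoxeterSystem (alternatingWord)

theorem exists_of_mem_rightInvSeq_alternatingWord {i k : B} {n : ℕ} {t : W}
    (h : t ∈ cs.rightInvSeq (alternatingWord i k n)) :
    ∃ l < n, t = (cs.simple k * cs.simple i) ^ l * cs.simple k := by
  induction n generalizing i k t with
  | zero => simp [alternatingWord] at h
  | succ n ih =>
    rw [CoxeterSystem.alternatingWord_succ, cs.rightInvSeq_concat, List.concat_eq_append,
      List.mem_append, List.mem_map, List.mem_singleton] at h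
    rcases h with ⟨t', ht', rfl⟩ | rfl
    · obtain ⟨l, hl, rfl⟩ := ih ht'
      refine ⟨l + 1, by omega, ?_⟩
      have key : ∀ l : ℕ, cs.simple k * (cs.simple i * cs.simple k) ^ l =
          (cs.simple k * cs.simple i) ^ l * cs.simple k := by
        intro l
        induction l with
        | zero => simp
        | succ l ihl => rw [pow_succ, ← mul_assoc, ihl, pow_succ]; simp only [mul_assoc]
      rw [MulAut.conj_apply, ← mul_assoc, key, pow_succ, cs.inv_simple]
      simp only [mul_assoc]
    · exact ⟨0, by omega, by simp⟩

theorem not_length_alternatingWord_mul_lt {i k : B} (hik : i ≠ k) {n : ℕ}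
    (hn : M i k = 0 ∨ n < M i k) :
    ¬ cs.length (cs.wordProd (alternatingWord i k n) * cs.simple i) <
      cs.length (cs.wordProd (alternatingWord i k n)) := by
  intro h
  obtain ⟨l, hl, e⟩ := exists_of_mem_rightInvSeq_alternatingWord cs
    (mem_rightInvSeq_of_length_lt cs (cs.isReflection_simple i) h)
  refine simple_mul_simple_pow_ne_one cs hik.symm (n := l + 1) (by omega) ?_ ?_
  · rw [M.symmetric]; omega
  · rw [pow_succ, ← mul_assoc, ← e, cs.simple_mul_simple_self]

/-- An alternating word in two generators is reduced as long as it is not longer than the bond. -/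
theorem isReduced_alternatingWord {i k : B} (hik : i ≠ k) {n : ℕ}
    (hn : M i k = 0 ∨ n ≤ M i k) : cs.IsReduced (alternatingWord i k n) := by
  induction n generalizing i k with
  | zero => simp [alternatingWord, CoxeterSystem.IsReduced]
  | succ n ih =>
    have hn' : M k i = 0 ∨ n < M k i := by rw [M.symmetric]; omega
    have h1 := ih hik.symm (by omega)
    have h2 := not_length_alternatingWord_mul_lt cs hik.symm hn'
    have h3 := cs.length_mul_simple (cs.wordProd (alternatingWord k i n)) k
    unfold CoxeterSystem.IsReduced at h1 ⊢
    rw [CoxeterSystem.alternatingWord_succ, cs.wordProd_concat, List.length_concat]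
    omega

theorem exists_eq_mul_alternatingWord_succ {i k : B} (hik : i ≠ k) {n : ℕ}
    (hn : M i k = 0 ∨ n < M i k) {w x : W} (hw : w = x * cs.wordProd (alternatingWord i k n))
    (hl : cs.length w = cs.length x + n) (hi : cs.IsRightDescent w i) :
    ∃ x', w = x' * cs.wordProd (alternatingWord k i (n + 1)) ∧
      cs.length w = cs.length x' + (n + 1) := by
  have h := not_length_alternatingWord_mul_lt cs hik hn
  set v := cs.wordProd (alternatingWord i k n) with hv
  have ht := cs.isReflection_simple i
  unfold CoxeterSystem.IsRightDescent at hi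
  rw [hw, length_mul_mul_lt_iff cs ht] at hi
  have hx : cs.length (x * (v * cs.simple i * v⁻¹)) < cs.length x := by tauto
  have e : cs.wordProd (alternatingWord k i (n + 1)) = v * cs.simple i := by
    rw [CoxeterSystem.alternatingWord_succ, cs.wordProd_concat]
  have e' : w = x * (v * cs.simple i * v⁻¹) * cs.wordProd (alternatingWord k i (n + 1)) := by
    rw [e, hw]
    simp [mul_assoc]
  refine ⟨_, e', ?_⟩
  have h1 := cs.length_mul_le (x * (v * cs.simple i * v⁻¹))
    (cs.wordProd (alternatingWord k i (n + 1)))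
  have h2 := cs.length_wordProd_le (alternatingWord k i (n + 1))
  rw [← e'] at h1
  rw [CoxeterSystem.length_alternatingWord] at h2
  omega

/-- An element with two right descents `i` and `k` ends in alternating words in `i` and `k` of any
length up to the bond. -/
theorem exists_eq_mul_alternatingWord {i k : B} (hik : i ≠ k) {w : W}
    (hi : cs.IsRightDescent w i) (hk : cs.IsRightDescent w k) (n : ℕ)
    (hn : M i k = 0 ∨ n ≤ M i k) :
    (∃ x, w = x * cs.wordProd (alternatingWord i k n) ∧ cs.length w = cs.length x + n) ∧
      ∃ x, w = x * cs.wordProd (alternatingWord k i n) ∧ cs.length w = cs.length x + n := by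
  induction n with
  | zero => simp [alternatingWord]
  | succ n ih =>
    obtain ⟨⟨x, hx, hxl⟩, y, hy, hyl⟩ := ih (by omega)
    have hn' : M k i = 0 ∨ n < M k i := by rw [M.symmetric]; omega
    exact ⟨exists_eq_mul_alternatingWord_succ cs hik.symm hn' hy hyl hk,
      exists_eq_mul_alternatingWord_succ cs hik (by omega) hx hxl hi⟩

variable {B' : Type*} (j : B' → B)

/-- A product of generators of a subdiagram has a reduced word in the same generators. -/
theorem exists_isReduced_map (ω : List B') :
    ∃ ω' : List B', cs.IsReduced (ω'.map j) ∧
      cs.wordProd (ω'.map j) = cs.wordProd (ω.map j) := by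
  induction ω with
  | nil => exact ⟨[], by simp [CoxeterSystem.IsReduced], rfl⟩
  | cons a ω ih =>
    obtain ⟨ω', hr, he⟩ := ih
    by_cases h : cs.IsLeftDescent (cs.wordProd (ω'.map j)) (j a)
    · obtain ⟨k, hk, e⟩ := exists_eraseIdx_of_isLeftDescent cs h
      rw [List.eraseIdx_map] at e
      refine ⟨ω'.eraseIdx k, ?_, ?_⟩
      · rw [cs.isLeftDescent_iff, e, hr] at h
        rw [List.length_map] at h hk
        unfold CoxeterSystem.IsReduced
        rw [List.length_map, List.length_eraseIdx_of_lt hk]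
        omega
      · rw [← e, he, List.map_cons, cs.wordProd_cons]
    · refine ⟨a :: ω', ?_, ?_⟩
      · rw [cs.not_isLeftDescent_iff, hr] at h
        unfold CoxeterSystem.IsReduced
        rw [List.map_cons, cs.wordProd_cons, h, List.length_cons]
      · rw [List.map_cons, List.map_cons, cs.wordProd_cons, cs.wordProd_cons, he]

theorem isReduced_of_isReduced_concat {ω : List B} {i : B} (h : cs.IsReduced (ω.concat i)) :
    cs.IsReduced ω := by
  have := h.take ω.length
  simpa using this

/-- Matsumoto's theorem: a family in a monoid that satisfies the braid relations takes the same
product along two reduced words for the same element. It is stated for words in the vertices of a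
full subdiagram, the braid relations being required only there. -/
theorem prod_map_eq_of_isReduced {M' : CoxeterMatrix B'} (hj : ∀ a b, M (j a) (j b) = M' a b)
    {G : Type*} [Monoid G] (a : B' → G)
    (hbraid : ∀ s t, M' s t ≠ 0 → ((CoxeterSystem.braidWord M' s t).map a).prod =
      ((CoxeterSystem.braidWord M' t s).map a).prod)
    {ω ω' : List B'} (hω : cs.IsReduced (ω.map j)) (hω' : cs.IsReduced (ω'.map j))
    (h : cs.wordProd (ω.map j) = cs.wordProd (ω'.map j)) : (ω.map a).prod = (ω'.map a).prod := by
  induction hn : ω.length generalizing ω ω' with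
  | zero =>
    have hl : (ω.map j).length = (ω'.map j).length := by rw [← hω.eq, ← hω'.eq, h]
    simp only [List.length_map] at hl
    rw [List.length_eq_zero_iff.1 hn, List.length_eq_zero_iff.1 (hl.symm.trans hn)]
  | succ n ih =>
    have hl : (ω.map j).length = (ω'.map j).length := by rw [← hω.eq, ← hω'.eq, h]
    simp only [List.length_map] at hl
    rcases List.eq_nil_or_concat ω with rfl | ⟨ω₁, s, rfl⟩
    · simp at hn
    rcases List.eq_nil_or_concat ω' with rfl | ⟨ω₁', t, rfl⟩
    · simp at hl
    -- two words with the same last letter are compared by induction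
    have step : ∀ (u : B') (η η' : List B'), η.length = n → cs.IsReduced ((η.concat u).map j) →
        cs.IsReduced ((η'.concat u).map j) →
        cs.wordProd ((η.concat u).map j) = cs.wordProd ((η'.concat u).map j) →
        ((η.concat u).map a).prod = ((η'.concat u).map a).prod := by
      intro u η η' hη h1 h2 h3
      rw [List.map_concat] at h1 h2 h3
      rw [List.map_concat, cs.wordProd_concat, cs.wordProd_concat] at h3
      rw [List.map_concat, List.map_concat, List.prod_concat, List.prod_concat,
        ih (isReduced_of_isReduced_concat cs h1) (isReduced_of_isReduced_concat cs h2)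
          (mul_right_cancel h3) hη]
    by_cases hst : s = t
    · subst hst
      exact step s ω₁ ω₁' (by simpa using hn) hω hω' h
    have hjst : j s ≠ j t := by
      intro e
      have := M'.off_diagonal s t hst
      rw [← hj, e, M.diagonal] at this
      exact this rfl
    set w := cs.wordProd ((ω₁.concat s).map j) with hw
    have hds : cs.IsRightDescent w (j s) := by
      rw [cs.isRightDescent_iff, hω.eq, hw, List.map_concat, cs.wordProd_concat,
        cs.simple_mul_simple_cancel_right,
        (isReduced_of_isReduced_concat cs (by rwa [List.map_concat] at hω)).eq]
      simp
    have hdt : cs.IsRightDescent w (j t) := by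
      rw [cs.isRightDescent_iff, h, hω'.eq, List.map_concat, cs.wordProd_concat,
        cs.simple_mul_simple_cancel_right,
        (isReduced_of_isReduced_concat cs (by rwa [List.map_concat] at hω')).eq]
      simp
    -- without a braid relation `w` would end in arbitrarily long alternating words
    have hM0 : M (j s) (j t) ≠ 0 := by
      intro h0
      obtain ⟨⟨x, -, hx⟩, -⟩ := exists_eq_mul_alternatingWord cs hjst hds hdt
        (cs.length w + 1) (Or.inl h0)
      omega
    obtain ⟨⟨x, hx, hxl⟩, -⟩ := exists_eq_mul_alternatingWord cs hjst hds hdt _ (Or.inr le_rfl)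
    -- both words are compared with words ending in the two braid words
    obtain ⟨ξ, hξ, hξe⟩ := exists_isReduced_map cs j
      ((ω₁.concat s) ++ (CoxeterSystem.braidWord M' s t).reverse)
    have hbs : CoxeterSystem.braidWord M (j s) (j t) =
        (CoxeterSystem.braidWord M' s t).map j := HeckeAlgebra.map_braidWord j hj s t
    have hbt : CoxeterSystem.braidWord M (j t) (j s) =
        (CoxeterSystem.braidWord M' t s).map j := HeckeAlgebra.map_braidWord j hj t s
    have hξx : cs.wordProd (ξ.map j) = x := by
      rw [hξe, List.map_append, List.map_reverse, ← hbs, cs.wordProd_append, ← hw, hx,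
        cs.wordProd_reverse]
      simp
    have hwt : cs.wordProd ((ξ ++ CoxeterSystem.braidWord M' s t).map j) = w := by
      rw [List.map_append, ← hbs, cs.wordProd_append, hξx, hx]
    have hws : cs.wordProd ((ξ ++ CoxeterSystem.braidWord M' t s).map j) = w := by
      rw [List.map_append, ← hbt, cs.wordProd_append, hξx, hx, ← cs.wordProd_braidWord_eq]
    have hlen : cs.length w = ξ.length + M' s t := by
      rw [hxl, ← hξx, hξ.eq, List.length_map, hj]
    have hrt : cs.IsReduced ((ξ ++ CoxeterSystem.braidWord M' s t).map j) := by
      unfold CoxeterSystem.IsReduced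
      rw [hwt, hlen]
      simp
    have hrs : cs.IsReduced ((ξ ++ CoxeterSystem.braidWord M' t s).map j) := by
      unfold CoxeterSystem.IsReduced
      rw [hws, hlen]
      simp [M'.symmetric t s]
    have hM' : M' s t ≠ 0 := by rwa [← hj]
    obtain ⟨l, hl'⟩ := Nat.exists_eq_succ_of_ne_zero hM'
    have es : ξ ++ CoxeterSystem.braidWord M' t s = (ξ ++ alternatingWord s t l).concat s := by
      unfold CoxeterSystem.braidWord
      rw [M'.symmetric t s, hl', Nat.succ_eq_add_one, CoxeterSystem.alternatingWord_succ]
      simp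
    have et : ξ ++ CoxeterSystem.braidWord M' s t = (ξ ++ alternatingWord t s l).concat t := by
      unfold CoxeterSystem.braidWord
      rw [hl', Nat.succ_eq_add_one, CoxeterSystem.alternatingWord_succ]
      simp
    have h1 := step s ω₁ _ (by simpa using hn) hω (es ▸ hrs) (by rw [← es, hws])
    have h2 := step t ω₁' _ (by simp at hn hl; omega) hω' (et ▸ hrt) (by rw [← et, hwt, ← h])
    rw [h1, h2, ← es, ← et, List.map_append, List.map_append, List.prod_append, List.prod_append,
      hbraid s t hM']

end Matsumoto

/-! ### Standard parabolic subgroups -/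

section Parabolic

variable {B B' W : Type*} [Group W] {M : CoxeterMatrix B} {M' : CoxeterMatrix B'}
  (cs : CoxeterSystem M W) (j : B' → B) (hj : ∀ a b, M (j a) (j b) = M' a b)

/-- If right multiplication by `s_k` turns `i` into a left descent, then `s_i x = x s_k`. -/
theorem simple_mul_eq_mul_simple {x : W} {i k : B} (h : ¬ cs.IsLeftDescent x i)
    (h' : cs.IsLeftDescent (x * cs.simple k) i) : cs.simple i * x = x * cs.simple k := by
  rw [← cs.isRightDescent_inv_iff] at h h'
  unfold CoxeterSystem.IsRightDescent at h h'
  rw [mul_inv_rev, cs.inv_simple, length_mul_mul_lt_iff cs (cs.isReflection_simple i),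
    cs.length_simple] at h'
  have h0 : cs.length (cs.simple k * (x⁻¹ * cs.simple i * x⁻¹⁻¹)) < 1 := by tauto
  rw [Nat.lt_one_iff, cs.length_eq_zero_iff, inv_inv] at h0
  have e : cs.simple k = x⁻¹ * cs.simple i * x := by
    have := mul_eq_one_iff_inv_eq.1 h0
    rwa [cs.inv_simple] at this
  rw [e]
  group

theorem parabolicHom_simple (a : B') :
    parabolicHom cs j hj (M'.toCoxeterSystem.simple a) = cs.simple (j a) := by
  unfold parabolicHom
  exact CoxeterSystem.lift_apply_simple _ _ _

theorem parabolicHom_wordProd (ω : List B') :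
    parabolicHom cs j hj (M'.toCoxeterSystem.wordProd ω) = cs.wordProd (ω.map j) := by
  induction ω with
  | nil => simp
  | cons a ω ih => simp only [CoxeterSystem.wordProd_cons, map_mul, parabolicHom_simple, ih,
      List.map_cons]

/-- Every element of the Coxeter group of the subdiagram has a word whose image in `W` is
reduced. -/
theorem exists_wordProd_eq_isReduced_map (hj : ∀ a b, M (j a) (j b) = M' a b) (y : M'.Group) :
    ∃ ω : List B', y = M'.toCoxeterSystem.wordProd ω ∧ cs.IsReduced (ω.map j) := by
  induction y using M'.toCoxeterSystem.simple_induction_left with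
  | one => exact ⟨[], by simp, by simp [CoxeterSystem.IsReduced]⟩
  | mul_simple_left y a ih =>
    obtain ⟨ω, rfl, hω⟩ := ih
    by_cases h : cs.IsLeftDescent (cs.wordProd (ω.map j)) (j a)
    · -- by Matsumoto's theorem the word `ω` may be replaced by one that starts with `a`
      obtain ⟨ω', hω', he⟩ := exists_isReduced_map cs j (a :: ω)
      rw [List.map_cons, cs.wordProd_cons] at he
      have e : cs.wordProd (ω.map j) = cs.wordProd ((a :: ω').map j) := by
        rw [List.map_cons, cs.wordProd_cons, he, cs.simple_mul_simple_cancel_left]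
      have hr : cs.IsReduced ((a :: ω').map j) := by
        have h2 : cs.length (cs.wordProd (ω'.map j)) = ω'.length := by simpa using hω'.eq
        rw [cs.isLeftDescent_iff, ← he, h2] at h
        unfold CoxeterSystem.IsReduced
        rw [← e, ← h]
        simp
      have hm := prod_map_eq_of_isReduced cs j hj M'.toCoxeterSystem.simple
        (fun s t _ => M'.toCoxeterSystem.wordProd_braidWord_eq s t) hω hr e
      refine ⟨ω', ?_, hω'⟩
      change M'.toCoxeterSystem.wordProd ω = M'.toCoxeterSystem.wordProd (a :: ω') at hm
      rw [hm, CoxeterSystem.wordProd_cons, CoxeterSystem.simple_mul_simple_cancel_left]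
    · refine ⟨a :: ω, by rw [CoxeterSystem.wordProd_cons], ?_⟩
      rw [cs.not_isLeftDescent_iff, hω.eq] at h
      unfold CoxeterSystem.IsReduced
      rw [List.map_cons, cs.wordProd_cons, h, List.length_cons]

/-- The length of an element of a standard parabolic subgroup is the same in the subgroup and in
`W`. -/
theorem length_parabolicHom (y : M'.Group) :
    cs.length (parabolicHom cs j hj y) = M'.toCoxeterSystem.length y := by
  apply le_antisymm
  · obtain ⟨ω, hω, rfl⟩ := M'.toCoxeterSystem.exists_isReduced y
    rw [parabolicHom_wordProd, hω.eq]
    simpa using cs.length_wordProd_le (ω.map j)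
  · obtain ⟨ω, rfl, hω⟩ := exists_wordProd_eq_isReduced_map cs j hj y
    rw [parabolicHom_wordProd, hω.eq, List.length_map]
    exact M'.toCoxeterSystem.length_wordProd_le ω

theorem isReduced_map (hj : ∀ a b, M (j a) (j b) = M' a b) {ω : List B'}
    (hω : M'.toCoxeterSystem.IsReduced ω) :
    cs.IsReduced (ω.map j) := by
  unfold CoxeterSystem.IsReduced
  rw [← parabolicHom_wordProd cs j hj, length_parabolicHom, hω.eq, List.length_map]

/-- Lengths add in a product of an element of a standard parabolic subgroup and a minimal right
coset representative. -/
theorem length_parabolicHom_mul {x : W} (hx : x ∈ minReps cs (parabolicHom cs j hj).range)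
    (y : M'.Group) :
    cs.length (parabolicHom cs j hj y * x) = M'.toCoxeterSystem.length y + cs.length x := by
  obtain ⟨ω, hω, rfl⟩ := M'.toCoxeterSystem.exists_isReduced y
  rw [hω.eq]
  induction ω with
  | nil => simp
  | cons a ω ih =>
    have hω' : M'.toCoxeterSystem.IsReduced ω := by simpa using hω.drop 1
    have ih := ih hω'
    set u := parabolicHom cs j hj (M'.toCoxeterSystem.wordProd ω) with hu
    have e : parabolicHom cs j hj (M'.toCoxeterSystem.wordProd (a :: ω)) = cs.simple (j a) * u := by
      rw [CoxeterSystem.wordProd_cons, map_mul, parabolicHom_simple]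
    have hua : ¬ cs.length (u⁻¹ * cs.simple (j a)) < cs.length u⁻¹ := by
      rw [← cs.inv_simple, ← mul_inv_rev, cs.length_inv, cs.length_inv, ← e, length_parabolicHom,
        hω.eq, hu, length_parabolicHom, hω'.eq]
      simp
    have hlt : ¬ cs.IsLeftDescent (u * x) (j a) := by
      rw [← cs.isRightDescent_inv_iff]
      unfold CoxeterSystem.IsRightDescent
      rw [mul_inv_rev, length_mul_mul_lt_iff cs (cs.isReflection_simple _)]
      have : ¬ cs.length (x⁻¹ * (u⁻¹ * cs.simple (j a) * u⁻¹⁻¹)) < cs.length x⁻¹ := by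
        rw [← cs.length_inv, cs.length_inv x, not_lt]
        have hmem : u⁻¹ * cs.simple (j a) * u ∈ (parabolicHom cs j hj).range :=
          ⟨(M'.toCoxeterSystem.wordProd ω)⁻¹ * M'.toCoxeterSystem.simple a *
            M'.toCoxeterSystem.wordProd ω, by rw [map_mul, map_mul, map_inv, parabolicHom_simple]⟩
        have := hx _ hmem
        simpa [mul_assoc] using this
      tauto
    rw [cs.not_isLeftDescent_iff, ← mul_assoc, ← e, ih] at hlt
    rw [hlt, List.length_cons]
    omega

theorem exists_eq_parabolicHom_mul (w : W) :
    ∃ y, ∃ x ∈ minReps cs (parabolicHom cs j hj).range, w = parabolicHom cs j hj y * x := by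
  let g : M'.Group → ℕ := fun y => cs.length (parabolicHom cs j hj y⁻¹ * w)
  obtain ⟨y, hy⟩ : ∃ y, ∀ z, g y ≤ g z := ⟨Function.argmin g, fun z => Function.argmin_le g z⟩
  refine ⟨y, parabolicHom cs j hj y⁻¹ * w, ?_, by simp⟩
  rintro _ ⟨z, rfl⟩
  have := hy (y * z⁻¹)
  simpa [g, mul_assoc] using this

/-- Minimality in the coset of a standard parabolic subgroup can be tested on the generators. -/
theorem mem_minReps_range_iff {x : W} :
    x ∈ minReps cs (parabolicHom cs j hj).range ↔ ∀ a, ¬ cs.IsLeftDescent x (j a) := by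
  constructor
  · intro hx a h
    have := hx (cs.simple (j a)) ⟨M'.toCoxeterSystem.simple a, parabolicHom_simple cs j hj a⟩
    unfold CoxeterSystem.IsLeftDescent at h
    omega
  · intro h
    obtain ⟨y, x₀, hx₀, hx⟩ := exists_eq_parabolicHom_mul cs j hj x
    by_cases hy : y = 1
    · rw [hx, hy, map_one, one_mul]
      exact hx₀
    · obtain ⟨a, ha⟩ := M'.toCoxeterSystem.exists_leftDescent_of_ne_one hy
      exfalso
      apply h a
      unfold CoxeterSystem.IsLeftDescent at ha ⊢
      rw [hx, ← mul_assoc, ← parabolicHom_simple cs j hj, ← map_mul,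
        length_parabolicHom_mul cs j hj hx₀, length_parabolicHom_mul cs j hj hx₀]
      omega

theorem eq_of_parabolicHom_mul_eq {y y' : M'.Group} {x x' : W}
    (hx : x ∈ minReps cs (parabolicHom cs j hj).range)
    (hx' : x' ∈ minReps cs (parabolicHom cs j hj).range)
    (h : parabolicHom cs j hj y * x = parabolicHom cs j hj y' * x') : y = y' ∧ x = x' := by
  have e : x' = parabolicHom cs j hj (y'⁻¹ * y) * x := by
    rw [map_mul, mul_assoc, h, map_inv, inv_mul_cancel_left]
  have e' : x = parabolicHom cs j hj (y⁻¹ * y') * x' := by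
    rw [map_mul, mul_assoc, ← h, map_inv, inv_mul_cancel_left]
  have l := length_parabolicHom_mul cs j hj hx (y'⁻¹ * y)
  have l' := length_parabolicHom_mul cs j hj hx' (y⁻¹ * y')
  rw [← e] at l
  rw [← e'] at l'
  have h1 : y'⁻¹ * y = 1 := by
    rw [← M'.toCoxeterSystem.length_eq_zero_iff]
    omega
  refine ⟨(inv_mul_eq_one.1 h1).symm, ?_⟩
  rw [e, h1, map_one, one_mul]

/-- Deodhar's lemma: for a minimal right coset representative `x` of a standard parabolic subgroup,
`x s` is again one, or `x s = s' x` for a generator `s'` of the subgroup. -/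
theorem mul_simple_mem_minReps_or {x : W} (hx : x ∈ minReps cs (parabolicHom cs j hj).range)
    (s : B) : x * cs.simple s ∈ minReps cs (parabolicHom cs j hj).range ∨
      ∃ a, cs.simple (j a) * x = x * cs.simple s := by
  rw [or_iff_not_imp_left, mem_minReps_range_iff]
  intro h
  push Not at h
  obtain ⟨a, ha⟩ := h
  exact ⟨a, simple_mul_eq_mul_simple cs ((mem_minReps_range_iff cs j hj).1 hx a) ha⟩

/-- The minimal right coset representatives of a subgroup of a standard parabolic subgroup are the
products of those inside the parabolic subgroup and those of the parabolic subgroup. -/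
theorem parabolicHom_mul_mem_minReps_map_iff {G : Subgroup M'.Group} {y : M'.Group} {x : W}
    (hx : x ∈ minReps cs (parabolicHom cs j hj).range) :
    parabolicHom cs j hj y * x ∈ minReps cs (G.map (parabolicHom cs j hj)) ↔
      y ∈ minReps M'.toCoxeterSystem G := by
  have key : ∀ u : M'.Group, cs.length (parabolicHom cs j hj y * x) ≤
      cs.length (parabolicHom cs j hj u * (parabolicHom cs j hj y * x)) ↔
      M'.toCoxeterSystem.length y ≤ M'.toCoxeterSystem.length (u * y) := by
    intro u
    rw [← mul_assoc, ← map_mul, length_parabolicHom_mul cs j hj hx,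
      length_parabolicHom_mul cs j hj hx]
    omega
  constructor
  · intro h u hu
    exact (key u).1 (h _ ⟨u, hu, rfl⟩)
  · rintro h _ ⟨u, hu, rfl⟩
    exact (key u).2 (h u hu)

theorem bijOn_parabolicHom_mul (G : Subgroup M'.Group) :
    Set.BijOn (fun z : M'.Group × W => parabolicHom cs j hj z.1 * z.2)
      (minReps M'.toCoxeterSystem G ×ˢ minReps cs (parabolicHom cs j hj).range)
      (minReps cs (G.map (parabolicHom cs j hj))) := by
  refine ⟨?_, ?_, ?_⟩
  · rintro ⟨y, x⟩ ⟨hy, hx⟩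
    exact (parabolicHom_mul_mem_minReps_map_iff cs j hj hx).2 hy
  · rintro ⟨y, x⟩ ⟨-, hx⟩ ⟨y', x'⟩ ⟨-, hx'⟩ h
    obtain ⟨rfl, rfl⟩ := eq_of_parabolicHom_mul_eq cs j hj hx hx' h
    rfl
  · intro w hw
    obtain ⟨y, x, hx, rfl⟩ := exists_eq_parabolicHom_mul cs j hj w
    exact ⟨(y, x), ⟨(parabolicHom_mul_mem_minReps_map_iff cs j hj hx).1 hw, hx⟩, rfl⟩

end Parabolic

/-! ### The standard basis of the Hecke algebra -/

namespace HeckeAlgebra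

variable {K B W : Type*} [CommRing K] [Group W] {M : CoxeterMatrix B}
  (cs : CoxeterSystem M W) (q : B → Kˣ)

theorem gen_mul_gen (s : B) : gen M q s * gen M q s =
    1 + ((q s : K) - (((q s)⁻¹ : Kˣ) : K)) • gen M q s := by
  have h := gen_quadratic M q s
  have hq' : (((q s)⁻¹ : Kˣ) : K) * (q s : K) = 1 := (q s).inv_mul
  simp only [Algebra.algebraMap_eq_smul_one, sub_mul, mul_add, smul_mul_assoc, mul_smul_comm,
    one_mul, mul_one, smul_sub, smul_smul, hq', one_smul] at h
  refine sub_eq_zero.1 (Eq.trans ?_ h)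
  module

theorem basisElt_wordProd {ω : List B} (hω : cs.IsReduced ω) :
    basisElt cs q (cs.wordProd ω) = (ω.map (gen M q)).prod := by
  have h := (cs.exists_isReduced (cs.wordProd ω)).choose_spec
  have := prod_map_eq_of_isReduced cs id (fun _ _ => rfl) (gen M q) (fun s t => gen_braid M q s t)
    (ω := (cs.exists_isReduced (cs.wordProd ω)).choose) (ω' := ω)
    (by rw [List.map_id]; exact h.1) (by rwa [List.map_id])
    (by rw [List.map_id, List.map_id]; exact h.2.symm)
  exact this

@[simp] theorem basisElt_one : basisElt cs q 1 = 1 := by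
  have := basisElt_wordProd cs q (ω := []) (by simp [CoxeterSystem.IsReduced])
  simpa using this

theorem basisElt_mul {u v : W} (h : cs.length (u * v) = cs.length u + cs.length v) :
    basisElt cs q (u * v) = basisElt cs q u * basisElt cs q v := by
  obtain ⟨ω, hω, rfl⟩ := cs.exists_isReduced u
  obtain ⟨η, hη, rfl⟩ := cs.exists_isReduced v
  have hr : cs.IsReduced (ω ++ η) := by
    unfold CoxeterSystem.IsReduced
    rw [cs.wordProd_append, h, hω.eq, hη.eq, List.length_append]
  rw [← cs.wordProd_append, basisElt_wordProd cs q hr, basisElt_wordProd cs q hω,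
    basisElt_wordProd cs q hη, List.map_append, List.prod_append]

@[simp] theorem basisElt_simple (s : B) : basisElt cs q (cs.simple s) = gen M q s := by
  have := basisElt_wordProd cs q (ω := [s]) (by simp [CoxeterSystem.IsReduced])
  simpa using this

theorem basisElt_mul_simple {w : W} {s : B} (h : ¬ cs.IsRightDescent w s) :
    basisElt cs q (w * cs.simple s) = basisElt cs q w * gen M q s := by
  rw [cs.not_isRightDescent_iff] at h
  rw [basisElt_mul cs q (by rw [h, cs.length_simple]), basisElt_simple]

theorem basisElt_mul_gen_of_isRightDescent {w : W} {s : B} (h : cs.IsRightDescent w s) :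
    basisElt cs q w * gen M q s =
      basisElt cs q (w * cs.simple s) +
        ((q s : K) - (((q s)⁻¹ : Kˣ) : K)) • basisElt cs q w := by
  have h' := basisElt_mul_simple cs q (cs.isRightDescent_iff_not_isRightDescent_mul.1 h)
  rw [cs.simple_mul_simple_cancel_right] at h'
  rw [h', mul_assoc, gen_mul_gen, mul_add, mul_one, mul_smul_comm]

theorem basisElt_mul_gen_mem (w : W) (s : B) :
    basisElt cs q w * gen M q s ∈ Submodule.span K (Set.range (basisElt cs q)) := by
  by_cases h : cs.IsRightDescent w s
  · rw [basisElt_mul_gen_of_isRightDescent cs q h]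
    exact add_mem (Submodule.subset_span ⟨_, rfl⟩)
      (Submodule.smul_mem _ _ (Submodule.subset_span ⟨_, rfl⟩))
  · rw [← basisElt_mul_simple cs q h]
    exact Submodule.subset_span ⟨_, rfl⟩

theorem mul_gen_mem_span {x : HeckeAlgebra K M q} (s : B)
    (hx : x ∈ Submodule.span K (Set.range (basisElt cs q))) :
    x * gen M q s ∈ Submodule.span K (Set.range (basisElt cs q)) := by
  induction hx using Submodule.span_induction with
  | mem x hx =>
    obtain ⟨w, rfl⟩ := hx
    exact basisElt_mul_gen_mem cs q w s
  | zero => rw [zero_mul]; exact zero_mem _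
  | add x y _ _ hx hy => rw [add_mul]; exact add_mem hx hy
  | smul c x _ hx => rw [smul_mul_assoc]; exact Submodule.smul_mem _ _ hx

theorem induction_on {p : HeckeAlgebra K M q → Prop} (x : HeckeAlgebra K M q)
    (algebraMap : ∀ c : K, p (algebraMap K _ c)) (gen : ∀ s, p (gen M q s))
    (add : ∀ x y, p x → p y → p (x + y)) (mul : ∀ x y, p x → p y → p (x * y)) : p x := by
  obtain ⟨x, rfl⟩ := RingQuot.mkAlgHom_surjective K (HeckeRel K M q) x
  induction x using FreeAlgebra.induction with
  | grade0 c => rw [AlgHom.commutes]; exact algebraMap c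
  | grade1 s => exact gen s
  | mul x y hx hy => rw [map_mul]; exact mul _ _ hx hy
  | add x y hx hy => rw [map_add]; exact add _ _ hx hy

theorem span_range_basisElt : Submodule.span K (Set.range (basisElt cs q)) = ⊤ := by
  rw [eq_top_iff]
  intro x hx
  clear hx
  suffices ∀ y ∈ Submodule.span K (Set.range (basisElt cs q)),
      y * x ∈ Submodule.span K (Set.range (basisElt cs q)) by
    simpa using this 1 (Submodule.subset_span ⟨1, basisElt_one cs q⟩)
  induction x using induction_on with
  | algebraMap c =>
    intro y hy
    rw [← Algebra.commutes, ← Algebra.smul_def]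
    exact Submodule.smul_mem _ _ hy
  | gen s => exact fun y hy => mul_gen_mem_span cs q s hy
  | add x x' hx hx' =>
    intro y hy
    rw [mul_add]
    exact add_mem (hx y hy) (hx' y hy)
  | mul x x' hx hx' =>
    intro y hy
    rw [← mul_assoc]
    exact hx' _ (hx y hy)

/-! ### Linear independence of the standard basis -/

open Classical in
/-- Left multiplication by `H_s` in terms of the expected basis, on the free module over `W`. -/
noncomputable def leftOp (s : B) : Module.End K (W →₀ K) :=
  Finsupp.linearCombination K fun w => Finsupp.single (cs.simple s * w) (1 : K) +
    (if cs.IsLeftDescent w s then (q s : K) - (((q s)⁻¹ : Kˣ) : K) else 0) • Finsupp.single w 1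

open Classical in
/-- Right multiplication by `H_s` in terms of the expected basis, on the free module over `W`. -/
noncomputable def rightOp (s : B) : Module.End K (W →₀ K) :=
  Finsupp.linearCombination K fun w => Finsupp.single (w * cs.simple s) (1 : K) +
    (if cs.IsRightDescent w s then (q s : K) - (((q s)⁻¹ : Kˣ) : K) else 0) • Finsupp.single w 1

open Classical in
theorem leftOp_single (s : B) (w : W) : leftOp cs q s (Finsupp.single w 1) =
    Finsupp.single (cs.simple s * w) (1 : K) +
      (if cs.IsLeftDescent w s then (q s : K) - (((q s)⁻¹ : Kˣ) : K) else 0) •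
        Finsupp.single w 1 := by
  rw [leftOp, Finsupp.linearCombination_single, one_smul]

open Classical in
theorem rightOp_single (s : B) (w : W) : rightOp cs q s (Finsupp.single w 1) =
    Finsupp.single (w * cs.simple s) (1 : K) +
      (if cs.IsRightDescent w s then (q s : K) - (((q s)⁻¹ : Kˣ) : K) else 0) •
        Finsupp.single w 1 := by
  rw [rightOp, Finsupp.linearCombination_single, one_smul]

theorem end_finsupp_ext {ι : Type*} {F G : Module.End K (ι →₀ K)}
    (h : ∀ w, F (Finsupp.single w 1) = G (Finsupp.single w 1)) : F = G :=
  Finsupp.basisSingleOne.ext fun w => by simpa using h w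

/-- This is where the parameters have to agree on conjugate generators: if `s w = w t`, then `s` and
`t` are conjugate. -/
theorem leftOp_mul_rightOp
    (hq : ∀ s t : B, IsConj (cs.simple s) (cs.simple t) → q s = q t) (s t : B) :
    leftOp cs q s * rightOp cs q t = rightOp cs q t * leftOp cs q s := by
  classical
  refine end_finsupp_ext fun w => ?_
  simp only [Module.End.mul_apply, leftOp_single, rightOp_single, map_add, map_smul]
  have h1 := cs.length_simple_mul w s
  have h2 := cs.length_mul_simple w t
  have h3 := cs.length_simple_mul (w * cs.simple t) s
  have h4 := cs.length_mul_simple (cs.simple s * w) t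
  rw [← mul_assoc] at h3
  by_cases hst : cs.simple s * w = w * cs.simple t
  · have hqst : q s = q t := by
      apply hq
      rw [isConj_comm, isConj_iff]
      exact ⟨w, by rw [← hst, mul_inv_cancel_right]⟩
    have e1 : cs.IsLeftDescent w s ↔ cs.IsRightDescent w t := by
      unfold CoxeterSystem.IsLeftDescent CoxeterSystem.IsRightDescent
      rw [hst]
    have e2 : cs.IsLeftDescent (w * cs.simple t) s ↔ cs.IsRightDescent (cs.simple s * w) t := by
      unfold CoxeterSystem.IsLeftDescent CoxeterSystem.IsRightDescent
      rw [mul_assoc, hst]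
    simp only [e1, e2, hqst, ← mul_assoc, hst]
  · have e1 : cs.IsLeftDescent (w * cs.simple t) s ↔ cs.IsLeftDescent w s := by
      constructor
      · intro h
        by_contra h'
        exact hst (simple_mul_eq_mul_simple cs h' h)
      · intro h
        by_contra h'
        apply hst
        have := simple_mul_eq_mul_simple cs (k := t) h'
          (by rwa [cs.simple_mul_simple_cancel_right])
        rw [cs.simple_mul_simple_cancel_right] at this
        conv_rhs => rw [← this]
        rw [mul_assoc, cs.simple_mul_simple_cancel_right]
    have e2 : cs.IsRightDescent (cs.simple s * w) t ↔ cs.IsRightDescent w t := by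
      unfold CoxeterSystem.IsLeftDescent at e1
      unfold CoxeterSystem.IsRightDescent
      rw [← mul_assoc] at e1
      omega
    simp only [e1, e2, ← mul_assoc]
    module

/-- Every basis vector is the image of the unit under an operator that commutes with the left
multiplications. -/
theorem exists_commute_leftOp
    (hq : ∀ s t : B, IsConj (cs.simple s) (cs.simple t) → q s = q t) (w : W) :
    ∃ R : Module.End K (W →₀ K), (∀ s, Commute (leftOp cs q s) R) ∧
      R (Finsupp.single 1 1) = Finsupp.single w 1 := by
  classical
  induction w using cs.simple_induction_right with
  | one => exact ⟨1, fun s => Commute.one_right _, rfl⟩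
  | mul_simple_right w t ih =>
    obtain ⟨R, hR, hR1⟩ := ih
    refine ⟨rightOp cs q t * R - (if cs.IsRightDescent w t then
      (q t : K) - (((q t)⁻¹ : Kˣ) : K) else 0) • R, fun s => ?_, ?_⟩
    · have h₁ : Commute (leftOp cs q s) (rightOp cs q t * R) :=
        Commute.mul_right (leftOp_mul_rightOp cs q hq s t) (hR s)
      exact Commute.sub_right (R := Module.End K (W →₀ K)) h₁ ((hR s).smul_right _)
    · rw [LinearMap.sub_apply, LinearMap.smul_apply, Module.End.mul_apply, hR1, rightOp_single,
        add_sub_cancel_right]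

/-- An operator built from the left multiplications is determined by its value on the unit, because
it commutes with the right multiplications. -/
theorem prod_leftOp_ext
    (hq : ∀ s t : B, IsConj (cs.simple s) (cs.simple t) → q s = q t) {ω η : List B}
    (h : (ω.map (leftOp cs q)).prod (Finsupp.single 1 1) =
      (η.map (leftOp cs q)).prod (Finsupp.single 1 1)) :
    (ω.map (leftOp cs q)).prod = (η.map (leftOp cs q)).prod := by
  refine end_finsupp_ext fun w => ?_
  obtain ⟨R, hR, hw⟩ := exists_commute_leftOp cs q hq w
  have key : ∀ ω : List B, Commute (ω.map (leftOp cs q)).prod R := by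
    intro ω
    apply Commute.list_prod_left
    intro x hx
    obtain ⟨s, -, rfl⟩ := List.mem_map.1 hx
    exact hR s
  rw [← hw, ← Module.End.mul_apply, ← Module.End.mul_apply, (key ω).eq, (key η).eq,
    Module.End.mul_apply, Module.End.mul_apply, h]

theorem prod_leftOp_single_one {ω : List B} (hω : cs.IsReduced ω) :
    (ω.map (leftOp cs q)).prod (Finsupp.single 1 1) = Finsupp.single (cs.wordProd ω) 1 := by
  induction ω with
  | nil => simp
  | cons s ω ih =>
    have hω' : cs.IsReduced ω := by simpa using hω.drop 1
    have hs : ¬ cs.IsLeftDescent (cs.wordProd ω) s := by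
      rw [cs.not_isLeftDescent_iff, ← cs.wordProd_cons, hω.eq, hω'.eq, List.length_cons]
    rw [List.map_cons, List.prod_cons, Module.End.mul_apply, ih hω', leftOp_single, if_neg hs,
      cs.wordProd_cons]
    simp

theorem leftOp_quadratic (s : B) :
    (leftOp cs q s - algebraMap K _ (q s : K)) *
      (leftOp cs q s + algebraMap K _ (((q s)⁻¹ : Kˣ) : K)) = 0 := by
  classical
  have hq : (q s : K) * (((q s)⁻¹ : Kˣ) : K) = 1 := (q s).mul_inv
  refine end_finsupp_ext fun w => ?_
  simp only [Module.End.mul_apply, LinearMap.sub_apply, LinearMap.add_apply, map_add,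
    Module.algebraMap_end_apply, LinearMap.zero_apply, map_smul, leftOp_single,
    cs.simple_mul_simple_cancel_left]
  have h := cs.isLeftDescent_iff_not_isLeftDescent_mul (w := w) (i := s)
  by_cases h' : cs.IsLeftDescent w s
  · rw [if_pos h', if_neg (h.1 h')]
    match_scalars <;> grind
  · rw [if_neg h', if_pos (by tauto)]
    match_scalars <;> grind

theorem leftOp_braid
    (hq : ∀ s t : B, IsConj (cs.simple s) (cs.simple t) → q s = q t) (s t : B) :
    ((CoxeterSystem.braidWord M s t).map (leftOp cs q)).prod =
      ((CoxeterSystem.braidWord M t s).map (leftOp cs q)).prod := by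
  by_cases hst : s = t
  · rw [hst]
  apply prod_leftOp_ext cs q hq
  rw [prod_leftOp_single_one cs q (isReduced_alternatingWord cs hst (Or.inr le_rfl)),
    prod_leftOp_single_one cs q (isReduced_alternatingWord cs (Ne.symm hst) (Or.inr le_rfl)),
    cs.wordProd_braidWord_eq]

theorem linearIndependent_basisElt
    (hq : ∀ s t : B, IsConj (cs.simple s) (cs.simple t) → q s = q t) :
    LinearIndependent K (basisElt cs q) := by
  let ρ : HeckeAlgebra K M q →ₐ[K] Module.End K (W →₀ K) :=
    lift M q (leftOp cs q) (leftOp_quadratic cs q) (fun s t _ => leftOp_braid cs q hq s t)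
  let ev : HeckeAlgebra K M q →ₗ[K] (W →₀ K) :=
    (LinearMap.applyₗ (Finsupp.single (1 : W) (1 : K))).comp ρ.toLinearMap
  apply LinearIndependent.of_comp ev
  have : ev ∘ basisElt cs q = fun w => Finsupp.single w 1 := by
    funext w
    obtain ⟨ω, hω, rfl⟩ := cs.exists_isReduced w
    change ρ (basisElt cs q (cs.wordProd ω)) (Finsupp.single 1 1) = _
    rw [basisElt_wordProd cs q hω, map_list_prod, List.map_map,
      show (ρ ∘ gen M q : B → _) = leftOp cs q from funext fun s => lift_gen _ _ _ _ _ s,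
      prod_leftOp_single_one cs q hω]
  rw [this]
  simpa using (Finsupp.basisSingleOne (R := K) (ι := W)).linearIndependent

/-- The standard basis `(H_w)` of the Hecke algebra. -/
noncomputable def basis
    (hq : ∀ s t : B, IsConj (cs.simple s) (cs.simple t) → q s = q t) :
    Module.Basis W K (HeckeAlgebra K M q) :=
  .mk (linearIndependent_basisElt cs q hq) (span_range_basisElt cs q).ge

@[simp] theorem basis_apply
    (hq : ∀ s t : B, IsConj (cs.simple s) (cs.simple t) → q s = q t) (w : W) :
    basis cs q hq w = basisElt cs q w := by
  rw [basis, Module.Basis.mk_apply]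

variable {q} {B' : Type*} {M' : CoxeterMatrix B'} {q' : B' → Kˣ} {j : B' → B}
  (hj : ∀ a b, M (j a) (j b) = M' a b) (hqj : ∀ a, q (j a) = q' a)

theorem parabolicMap_gen (a : B') :
    parabolicMap j hj hqj (gen M' q' a) = gen M q (j a) :=
  lift_gen _ _ _ _ _ a

theorem parabolicMap_basisElt (y : M'.Group) :
    parabolicMap j hj hqj (basisElt M'.toCoxeterSystem q' y) =
      basisElt cs q (parabolicHom cs j hj y) := by
  obtain ⟨ω, hω, rfl⟩ := M'.toCoxeterSystem.exists_isReduced y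
  rw [parabolicHom_wordProd, basisElt_wordProd _ _ hω,
    basisElt_wordProd cs q (isReduced_map cs j hj hω), map_list_prod, List.map_map, List.map_map]
  congr 2
  funext a
  exact parabolicMap_gen hj hqj a

theorem basisElt_parabolicHom_mul {x : W} (hx : x ∈ minReps cs (parabolicHom cs j hj).range)
    (y : M'.Group) : basisElt cs q (parabolicHom cs j hj y * x) =
      parabolicMap j hj hqj (basisElt M'.toCoxeterSystem q' y) * basisElt cs q x := by
  rw [parabolicMap_basisElt cs, basisElt_mul]
  rw [length_parabolicHom_mul cs j hj hx, length_parabolicHom]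

end HeckeAlgebra

/-! ### Descents of words and minimal coset representatives in type `B` -/

section Words

variable {d r m : ℕ}

/-- The generator `s_i` lowers the word `g`: it exchanges an ascent `g(i) < g(i+1)`, or, if `i = 0`,
it changes the sign of a first letter in the positive part. -/
def IsDescent (i : Fin d) (g : LetterWord d r m) : Prop :=
  if i.1 = 0 then IsUpper (g i) else g (prev i) < g i

theorem isDescent_zero {i : Fin d} (hi : i.1 = 0) (g : LetterWord d r m) :
    IsDescent i g ↔ IsUpper (g i) := by rw [IsDescent, if_pos hi]

theorem isDescent_pos {i : Fin d} (hi : i.1 ≠ 0) (g : LetterWord d r m) :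
    IsDescent i g ↔ g (prev i) < g i := by rw [IsDescent, if_neg hi]

theorem prev_ne {i : Fin d} (hi : i.1 ≠ 0) : prev i ≠ i := by
  intro e
  simp [prev, Fin.ext_iff] at e
  omega

theorem IsUpper.not_isMiddle {a : Letter r m} (h : IsUpper a) : ¬ IsMiddle a := by
  unfold IsUpper at h
  unfold IsMiddle
  omega

theorem isDescent_or (i : Fin d) (g : LetterWord d r m) :
    IsDescent i g ∨ simpleAct i g = g ∨ IsDescent i (simpleAct i g) := by
  by_cases hi : i.1 = 0
  · rw [isDescent_zero hi, isDescent_zero hi, simpleAct_zero i hi]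
    by_cases h1 : IsMiddle (g i)
    · simp [h1]
    · have := isUpper_rev (g i) h1
      simp [h1]
      tauto
  · rw [isDescent_pos hi, isDescent_pos hi, simpleAct_pos i hi]
    simp only [Function.comp_apply, Equiv.swap_apply_left, Equiv.swap_apply_right]
    rcases lt_trichotomy (g (prev i)) (g i) with h | h | h
    · exact Or.inl h
    · refine Or.inr (Or.inl ?_)
      ext k
      simp only [Function.comp_apply, Equiv.swap_apply_def]
      grind
    · exact Or.inr (Or.inr h)

/-- A weight on words that drops along descents. -/
def wordWeight (g : LetterWord d r m) : ℕ := ∑ k, (k.1 + 1) * (g k).1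

theorem wordWeight_simpleAct_lt {i : Fin d} {g : LetterWord d r m} (h : IsDescent i g) :
    wordWeight (simpleAct i g) < wordWeight g := by
  unfold wordWeight
  by_cases hi : i.1 = 0
  · rw [isDescent_zero hi] at h
    rw [simpleAct_zero i hi, if_neg h.not_isMiddle]
    have hlt : (g i).rev.1 < (g i).1 := by
      unfold IsUpper at h
      rw [Fin.val_rev]
      omega
    refine Finset.sum_lt_sum (fun k _ => ?_) ⟨i, Finset.mem_univ i, ?_⟩
    · by_cases hk : k = i
      · subst hk
        simp only [Function.update_self]
        gcongr
      · simp [hk]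
    · simp only [Function.update_self]
      exact Nat.mul_lt_mul_of_pos_left hlt (by omega)
  · rw [isDescent_pos hi] at h
    have hp := prev_ne hi
    have hmem : prev i ∈ Finset.univ.erase i := by simp [hp]
    rw [simpleAct_pos i hi, ← Finset.add_sum_erase _ _ (Finset.mem_univ i),
      ← Finset.add_sum_erase _ _ hmem, ← Finset.add_sum_erase _ _ (Finset.mem_univ i),
      ← Finset.add_sum_erase _ (fun k : Fin d => (k.1 + 1) * (g k).1) hmem]
    have hrest : ∀ k ∈ (Finset.univ.erase i).erase (prev i),
        (k.1 + 1) * ((g ∘ Equiv.swap (prev i) i) k).1 = (k.1 + 1) * (g k).1 := by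
      intro k hk
      simp only [Finset.mem_erase, Finset.mem_univ, and_true] at hk
      rw [Function.comp_apply, Equiv.swap_apply_of_ne_of_ne hk.1 hk.2]
    rw [Finset.sum_congr rfl hrest]
    simp only [Function.comp_apply, Equiv.swap_apply_left, Equiv.swap_apply_right]
    have hv : (prev i).1 + 1 = i.1 := by simp only [prev]; omega
    have h' : (g (prev i)).1 < (g i).1 := h
    rw [← hv]
    -- the exchange moves the larger letter to the position of the smaller weight
    nlinarith

/-- A word without descents is antidominant. -/
theorem isAntidominant_of_forall_not_isDescent {g : LetterWord d r m}
    (h : ∀ i, ¬ IsDescent i g) : IsAntidominant g := by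
  rcases d with _ | d
  · exact ⟨fun a => a.elim0, fun a => a.elim0⟩
  have ha : Antitone g := by
    rw [Fin.antitone_iff_succ_le]
    intro i
    have := h i.succ
    rw [isDescent_pos (by simp), not_lt] at this
    exact this
  refine ⟨ha, fun i hu => h 0 ?_⟩
  rw [isDescent_zero rfl]
  exact le_trans hu (ha (Fin.zero_le i))

theorem IsAntidominant.not_isDescent {f : LetterWord d r m} (hf : IsAntidominant f) (i : Fin d) :
    ¬ IsDescent i f := by
  by_cases hi : i.1 = 0
  · rw [isDescent_zero hi]
    exact hf.2 i
  · rw [isDescent_pos hi, not_lt]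
    refine hf.1 ?_
    rw [Fin.le_def]
    simp [prev]

/-- The letter of a pair `±a` that is not in the positive part; middle letters are kept. -/
def foldLetter (a : Letter r m) : Letter r m := if IsUpper a then a.rev else a

theorem foldLetter_rev {a : Letter r m} (h : ¬ IsMiddle a) : foldLetter a.rev = foldLetter a := by
  have := isUpper_rev a h
  unfold foldLetter
  by_cases hu : IsUpper a <;> simp [hu, this]

/-- Up to the order of the letters, the folded word is an invariant of the orbit. -/
theorem exists_perm_foldLetter_act (f : LetterWord d r m) (τ : (typeB d).Group) :
    ∃ π : Equiv.Perm (Fin d), foldLetter ∘ act f τ = (foldLetter ∘ f) ∘ π := by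
  induction τ using (typeB d).toCoxeterSystem.simple_induction_right with
  | one => exact ⟨1, by rw [act_one]; rfl⟩
  | mul_simple_right τ i ih =>
    obtain ⟨π, hπ⟩ := ih
    rw [act_mul, act_simple]
    by_cases hi : i.1 = 0
    · refine ⟨π, ?_⟩
      rw [← hπ, simpleAct_zero i hi]
      split_ifs with h1
      · rfl
      · ext1 k
        by_cases hk : k = i
        · subst hk
          simp [foldLetter_rev h1]
        · simp [hk]
    · refine ⟨π * Equiv.swap (prev i) i, ?_⟩
      rw [simpleAct_pos i hi, ← Function.comp_assoc, hπ]
      rfl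

theorem IsAntidominant.foldLetter_comp {f : LetterWord d r m} (hf : IsAntidominant f) :
    foldLetter ∘ f = f := by
  ext1 k
  simp [foldLetter, hf.2 k]

/-- There is only one antidominant word in an orbit. -/
theorem IsAntidominant.act_eq {f : LetterWord d r m} (hf : IsAntidominant f) {τ : (typeB d).Group}
    (h : IsAntidominant (act f τ)) : act f τ = f := by
  obtain ⟨π, hπ⟩ := exists_perm_foldLetter_act f τ
  rw [h.foldLetter_comp, hf.foldLetter_comp] at hπ
  have h1 : Monotone ((OrderDual.toDual ∘ f) ∘ (1 : Equiv.Perm (Fin d))) := hf.1.dual_right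
  have h2 : Monotone ((OrderDual.toDual ∘ f) ∘ π) := by
    rw [Function.comp_assoc, ← hπ]
    exact h.1.dual_right
  have := Tuple.unique_monotone h2 h1
  rw [hπ]
  exact this

/-- `DescPath f n σ g`: there is a path of `n` descents from the word `g` down to `f`, and `σ` is
the product, in the order from `f` to `g`, of the generators that occur. -/
inductive DescPath (f : LetterWord d r m) : ℕ → (typeB d).Group → LetterWord d r m → Prop
  | nil : DescPath f 0 1 f
  | cons {n : ℕ} {σ : (typeB d).Group} {g : LetterWord d r m} (i : Fin d)
      (h : DescPath f n σ (simpleAct i g)) (hi : IsDescent i g) :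
      DescPath f (n + 1) (σ * (typeB d).toCoxeterSystem.simple i) g

theorem DescPath.act_eq {f g : LetterWord d r m} {n : ℕ} {σ : (typeB d).Group}
    (h : DescPath f n σ g) : act f σ = g := by
  induction h with
  | nil => exact act_one f
  | cons i _ _ ih => rw [act_mul, act_simple, ih, simpleAct_simpleAct]

theorem DescPath.length_le {f g : LetterWord d r m} {n : ℕ} {σ : (typeB d).Group}
    (h : DescPath f n σ g) : (typeB d).toCoxeterSystem.length σ ≤ n := by
  induction h with
  | nil => simp
  | cons i _ _ ih =>
    refine ((typeB d).toCoxeterSystem.length_mul_le _ _).trans ?_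
    rw [CoxeterSystem.length_simple]
    omega

theorem exists_descPath {f : LetterWord d r m} (hf : IsAntidominant f) (τ : (typeB d).Group) :
    ∃ n σ, DescPath f n σ (act f τ) := by
  induction hn : wordWeight (act f τ) using Nat.strong_induction_on generalizing τ with
  | _ N ih =>
    by_cases h : ∃ i, IsDescent i (act f τ)
    · obtain ⟨i, hi⟩ := h
      have e : simpleAct i (act f τ) = act f (τ * (typeB d).toCoxeterSystem.simple i) := by
        rw [act_mul, act_simple]
      obtain ⟨n, σ, hσ⟩ := ih _ (hn ▸ wordWeight_simpleAct_lt hi) _ (congrArg wordWeight e).symm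
      exact ⟨_, _, .cons i (e ▸ hσ) hi⟩
    · rw [hf.act_eq (isAntidominant_of_forall_not_isDescent (not_exists.1 h))]
      exact ⟨_, _, .nil⟩

/-! ### Confluence of descents -/

/-- Two generators `i < j` that are both descents of `g` lead on to a common word, along the two
sides of a braid relation. -/
theorem exists_confluence_of_lt {f g : LetterWord d r m} {i j : Fin d} (hij : i < j)
    (hi : IsDescent i g) (hj : IsDescent j g) :
    ∃ τ : (typeB d).Group, ∀ n ρ, DescPath f n ρ (act g τ) → ∃ n' σ₁ σ₂,
      DescPath f n' σ₁ (simpleAct i g) ∧ DescPath f n' σ₂ (simpleAct j g) ∧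
        σ₁ * (typeB d).toCoxeterSystem.simple i = σ₂ * (typeB d).toCoxeterSystem.simple j := by
  have hij' : i.1 < j.1 := hij
  have hj0 : j.1 ≠ 0 := by omega
  have hne : i ≠ j := hij.ne
  have hbraid := (typeB d).toCoxeterSystem.wordProd_braidWord_eq i j
  unfold CoxeterSystem.braidWord at hbraid
  rw [(typeB d).symmetric j i, typeB_apply, if_neg hne] at hbraid
  by_cases hc : i.1 + 1 < j.1
  · -- the generators commute
    rw [if_neg (by omega), if_neg (by omega)] at hbraid
    simp [CoxeterSystem.alternatingWord, CoxeterSystem.wordProd_cons] at hbraid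
    refine ⟨(typeB d).toCoxeterSystem.simple i * (typeB d).toCoxeterSystem.simple j, ?_⟩
    intro n ρ hρ
    rw [act_mul, act_simple, act_simple] at hρ
    have n1 : i ≠ prev j := by intro e; simp [prev, Fin.ext_iff] at e; omega
    have n2 : prev i ≠ j := by intro e; simp [prev, Fin.ext_iff] at e; omega
    have n3 : prev i ≠ prev j := by intro e; simp [prev, Fin.ext_iff] at e; omega
    have key : ∀ k, k ≠ i → k ≠ prev i → simpleAct i g k = g k := by
      intro k k1 k2
      by_cases hi : i.1 = 0
      · rw [simpleAct_zero i hi]; split_ifs <;> simp [k1]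
      · rw [simpleAct_pos i hi]; simp [Equiv.swap_apply_of_ne_of_ne k2 k1]
    have hj' : IsDescent j (simpleAct i g) := by
      rw [isDescent_pos hj0] at hj ⊢
      rwa [key _ hne.symm n2.symm, key _ n1.symm n3.symm]
    have hi' : IsDescent i (simpleAct j g) := by
      unfold IsDescent at hi ⊢
      have e1 : simpleAct j g i = g i := by
        rw [simpleAct_pos j hj0]; simp [Equiv.swap_apply_of_ne_of_ne n1 hne]
      have e2 : simpleAct j g (prev i) = g (prev i) := by
        rw [simpleAct_pos j hj0]; simp [Equiv.swap_apply_of_ne_of_ne n3 n2]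
      rwa [e1, e2]
    refine ⟨_, _, _, .cons j hρ hj', .cons i (by rwa [simpleAct_comm i j hc]) hi', ?_⟩
    rw [mul_assoc, mul_assoc]
    exact congrArg (ρ * ·) hbraid.symm
  have hp : prev j = i := by ext; simp [prev]; omega
  by_cases hi0 : i.1 = 0
  · -- the bond of label `4`
    rw [if_pos (by omega)] at hbraid
    simp [CoxeterSystem.alternatingWord, CoxeterSystem.wordProd_cons] at hbraid
    have T1 : ∀ x y, ¬ IsMiddle x →
        simpleAct i (patch₂ g i j x y) = patch₂ g i j x.rev y := by
      intro x y hx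
      rw [simpleAct_patch₂ i j hi0, if_neg hx]
    have T2 : ∀ x y, simpleAct j (patch₂ g i j x y) = patch₂ g i j y x := by
      intro x y
      rw [simpleAct_pos j hj0, hp, patch₂_swap g i j hne]
    have D1 : ∀ x y, IsUpper x → IsDescent i (patch₂ g i j x y) := by
      intro x y hx
      rw [isDescent_zero hi0]
      simpa [patch₂] using hx
    have D2 : ∀ x y, x < y → IsDescent j (patch₂ g i j x y) := by
      intro x y hx
      rw [isDescent_pos hj0, hp]
      simpa [patch₂, hne.symm] using hx
    rw [isDescent_zero hi0] at hi
    rw [isDescent_pos hj0, hp] at hj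
    refine ⟨(typeB d).toCoxeterSystem.simple i * (typeB d).toCoxeterSystem.simple j *
      (typeB d).toCoxeterSystem.simple i * (typeB d).toCoxeterSystem.simple j, ?_⟩
    intro n ρ hρ
    simp only [act_mul, act_simple] at hρ
    rw [← patch₂_self g i j] at hρ ⊢
    set x := g i
    set y := g j
    have hy : IsUpper y := le_trans hi (Fin.le_def.1 hj.le)
    have hx' := hi.not_isMiddle
    have hy' := hy.not_isMiddle
    have l1 : x.rev < y := by
      unfold IsUpper at hi hy
      rw [Fin.lt_def, Fin.val_rev]
      omega
    have l2 : y.rev < x := by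
      unfold IsUpper at hi hy
      rw [Fin.lt_def, Fin.val_rev]
      omega
    have l3 : y.rev < x.rev := Fin.rev_lt_rev.2 hj
    rw [T1 x y hx', T2 x.rev y, T1 y x.rev hy', T2] at hρ
    rw [T1 x y hx', T2 x y]
    have p1 : DescPath f _ _ (patch₂ g i j x.rev y) :=
      .cons j (by
        rw [T2]
        exact .cons i (by
          rw [T1 _ _ hy']
          exact .cons j (by rw [T2]; exact hρ) (D2 _ _ l3)) (D1 _ _ hy)) (D2 _ _ l1)
    have p2 : DescPath f _ _ (patch₂ g i j y x) :=
      .cons i (by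
        rw [T1 _ _ hy']
        exact .cons j (by
          rw [T2]
          exact .cons i (by rw [T1 _ _ hx']; exact hρ) (D1 _ _ hi)) (D2 _ _ l2)) (D1 _ _ hy)
    refine ⟨_, _, _, p1, p2, ?_⟩
    simp only [mul_assoc]
    exact congrArg (ρ * ·) hbraid.symm
  · -- a bond of label `3`
    rw [if_neg (by omega), if_pos (by omega)] at hbraid
    simp [CoxeterSystem.alternatingWord, CoxeterSystem.wordProd_cons] at hbraid
    have h1 : prev i ≠ i := prev_ne hi0
    have h2 : prev i ≠ j := by intro e; simp [prev, Fin.ext_iff] at e; omega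
    have T1 : ∀ x y z, simpleAct i (patch₃ g (prev i) i j x y z) =
        patch₃ g (prev i) i j y x z := by
      intro x y z
      rw [simpleAct_pos i hi0, patch₃_swap_left g _ _ _ h1]
    have T2 : ∀ x y z, simpleAct j (patch₃ g (prev i) i j x y z) =
        patch₃ g (prev i) i j x z y := by
      intro x y z
      rw [simpleAct_pos j hj0, hp, patch₃_swap_right g _ _ _ h1 h2 hne]
    have D1 : ∀ x y z, x < y → IsDescent i (patch₃ g (prev i) i j x y z) := by
      intro x y z hx
      rw [isDescent_pos hi0]
      simpa [patch₃, h1.symm] using hx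
    have D2 : ∀ x y z, y < z → IsDescent j (patch₃ g (prev i) i j x y z) := by
      intro x y z hx
      rw [isDescent_pos hj0, hp]
      simpa [patch₃, h1.symm, h2.symm, hne.symm] using hx
    rw [isDescent_pos hi0] at hi
    rw [isDescent_pos hj0, hp] at hj
    refine ⟨(typeB d).toCoxeterSystem.simple i * (typeB d).toCoxeterSystem.simple j *
      (typeB d).toCoxeterSystem.simple i, ?_⟩
    intro n ρ hρ
    simp only [act_mul, act_simple] at hρ
    rw [← patch₃_self g (prev i) i j] at hρ ⊢
    set x := g (prev i)
    set y := g i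
    set z := g j
    rw [T1, T2, T1] at hρ
    rw [T1, T2]
    have p1 : DescPath f _ _ (patch₃ g (prev i) i j y x z) :=
      .cons j (by
        rw [T2]
        exact .cons i (by rw [T1]; exact hρ) (D1 _ _ _ hj)) (D2 _ _ _ (hi.trans hj))
    have p2 : DescPath f _ _ (patch₃ g (prev i) i j x z y) :=
      .cons i (by
        rw [T1]
        exact .cons j (by rw [T2]; exact hρ) (D2 _ _ _ hi)) (D1 _ _ _ (hi.trans hj))
    refine ⟨_, _, _, p1, p2, ?_⟩
    simp only [mul_assoc]
    exact congrArg (ρ * ·) hbraid.symm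

/-- All paths of descents from a word to an antidominant word have the same length and the same
product. -/
theorem DescPath.unique {f : LetterWord d r m} (hf : IsAntidominant f) {g : LetterWord d r m}
    {n n' : ℕ} {σ σ' : (typeB d).Group} (h : DescPath f n σ g) (h' : DescPath f n' σ' g) :
    n = n' ∧ σ = σ' := by
  induction hN : wordWeight g using Nat.strong_induction_on generalizing g n n' σ σ' with
  | _ N ih =>
    have orbit : ∀ τ : (typeB d).Group, ∃ n ρ, DescPath f n ρ (act g τ) := by
      intro τ
      rw [← h.act_eq, ← act_mul]
      exact exists_descPath hf _
    have key : ∀ {n n' : ℕ} {σ σ' : (typeB d).Group} {i j : Fin d}, i < j → IsDescent i g →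
        IsDescent j g → DescPath f n σ (simpleAct i g) → DescPath f n' σ' (simpleAct j g) →
        n = n' ∧ σ * (typeB d).toCoxeterSystem.simple i =
          σ' * (typeB d).toCoxeterSystem.simple j := by
      intro n n' σ σ' i j hij hi hj h h'
      obtain ⟨τ, hτ⟩ := exists_confluence_of_lt (f := f) hij hi hj
      obtain ⟨k, ρ, hρ⟩ := orbit τ
      obtain ⟨l, σ₁, σ₂, h₁, h₂, e⟩ := hτ k ρ hρ
      obtain ⟨rfl, rfl⟩ := ih _ (hN ▸ wordWeight_simpleAct_lt hi) h h₁ rfl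
      obtain ⟨rfl, rfl⟩ := ih _ (hN ▸ wordWeight_simpleAct_lt hj) h' h₂ rfl
      exact ⟨rfl, e⟩
    cases h with
    | nil =>
      cases h' with
      | nil => exact ⟨rfl, rfl⟩
      | cons i _ hi => exact absurd hi (hf.not_isDescent i)
    | cons i h hi =>
      cases h' with
      | nil => exact absurd hi (hf.not_isDescent i)
      | cons j h' hj =>
        rcases lt_trichotomy i j with hij | rfl | hij
        · obtain ⟨rfl, e⟩ := key hij hi hj h h'
          exact ⟨rfl, e⟩
        · obtain ⟨rfl, rfl⟩ := ih _ (hN ▸ wordWeight_simpleAct_lt hi) h h' rfl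
          exact ⟨rfl, rfl⟩
        · obtain ⟨rfl, e⟩ := key hij hj hi h' h
          exact ⟨rfl, e.symm⟩

/-- A path of descents is not longer than any word leading from `f` to the same word of letters,
since each generator changes the length of such a path by at most one; a word of the same length
has the same product. -/
theorem DescPath.le_length_word {f : LetterWord d r m} (hf : IsAntidominant f)
    (ω : List (Fin d)) {n : ℕ} {σ : (typeB d).Group}
    (h : DescPath f n σ (act f ((typeB d).toCoxeterSystem.wordProd ω))) :
    n ≤ ω.length ∧ (ω.length = n → (typeB d).toCoxeterSystem.wordProd ω = σ) := by
  induction ω using List.reverseRecOn generalizing n σ with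
  | nil =>
    rw [CoxeterSystem.wordProd_nil, act_one] at h
    obtain ⟨rfl, rfl⟩ := h.unique hf .nil
    simp
  | append_singleton ω i ih =>
    rw [← List.concat_eq_append, CoxeterSystem.wordProd_concat] at h ⊢
    rw [act_mul, act_simple] at h
    rw [List.length_concat]
    obtain ⟨n₁, σ₁, h₁⟩ := exists_descPath hf ((typeB d).toCoxeterSystem.wordProd ω)
    obtain ⟨hle, heq⟩ := ih h₁
    rcases isDescent_or i (act f ((typeB d).toCoxeterSystem.wordProd ω)) with hi | hi | hi
    · obtain ⟨rfl, -⟩ := (DescPath.cons i h hi).unique hf h₁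
      exact ⟨by omega, by omega⟩
    · rw [hi] at h
      obtain ⟨rfl, -⟩ := h.unique hf h₁
      exact ⟨by omega, by omega⟩
    · obtain ⟨rfl, rfl⟩ := h.unique hf (.cons i (by rwa [simpleAct_simpleAct]) hi)
      refine ⟨by omega, fun e => ?_⟩
      rw [heq (by omega)]

theorem DescPath.le_length {f g : LetterWord d r m} (hf : IsAntidominant f) {n : ℕ}
    {σ τ : (typeB d).Group} (h : DescPath f n σ g) (hτ : act f τ = g) :
    n ≤ (typeB d).toCoxeterSystem.length τ ∧
      ((typeB d).toCoxeterSystem.length τ = n → τ = σ) := by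
  obtain ⟨ω, hω, rfl⟩ := (typeB d).toCoxeterSystem.exists_isReduced τ
  rw [hω.eq]
  exact DescPath.le_length_word hf ω (hτ ▸ h)

theorem DescPath.length_eq {f g : LetterWord d r m} (hf : IsAntidominant f) {n : ℕ}
    {σ : (typeB d).Group} (h : DescPath f n σ g) : (typeB d).toCoxeterSystem.length σ = n :=
  le_antisymm h.length_le (h.le_length hf h.act_eq).1

/-! ### Minimal representatives of the stabilizer of an antidominant word -/

theorem mem_repsInB_iff_forall {f : LetterWord d r m} {σ : (typeB d).Group} :
    σ ∈ repsInB f ↔ ∀ τ, act f τ = act f σ →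
      (typeB d).toCoxeterSystem.length σ ≤ (typeB d).toCoxeterSystem.length τ := by
  constructor
  · intro h τ hτ
    have hmem : τ * σ⁻¹ ∈ stab f := by
      change act f (τ * σ⁻¹) = f
      rw [act_mul, hτ, ← act_mul, mul_inv_cancel, act_one]
    simpa using h _ hmem
  · intro h u hu
    apply h
    rw [act_mul, show act f u = f from hu]

/-- The minimal representatives are the products along paths of descents. -/
theorem mem_repsInB_iff {f : LetterWord d r m} (hf : IsAntidominant f) {σ : (typeB d).Group} :
    σ ∈ repsInB f ↔ ∃ n, DescPath f n σ (act f σ) := by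
  rw [mem_repsInB_iff_forall]
  constructor
  · intro h
    obtain ⟨n, σ', h'⟩ := exists_descPath hf σ
    have h1 := h σ' h'.act_eq
    have h2 := h'.le_length hf rfl
    have h3 := h'.length_le
    obtain rfl := h2.2 (by omega)
    exact ⟨n, h'⟩
  · rintro ⟨n, h⟩ τ hτ
    exact h.length_le.trans (h.le_length hf hτ).1

theorem injOn_act_repsInB {f : LetterWord d r m} (hf : IsAntidominant f) :
    Set.InjOn (act f) (repsInB f) := by
  intro σ hσ τ hτ h
  obtain ⟨n, hn⟩ := (mem_repsInB_iff hf).1 hσ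
  obtain ⟨k, hk⟩ := (mem_repsInB_iff hf).1 hτ
  exact (hn.unique hf (h ▸ hk)).2

theorem exists_mem_repsInB_act_eq {f : LetterWord d r m} (hf : IsAntidominant f)
    (τ : (typeB d).Group) : ∃ σ ∈ repsInB f, act f σ = act f τ := by
  obtain ⟨n, σ, h⟩ := exists_descPath hf τ
  refine ⟨σ, (mem_repsInB_iff hf).2 ⟨n, ?_⟩, h.act_eq⟩
  rwa [h.act_eq]

theorem mul_simple_mem_repsInB_of_isDescent {f : LetterWord d r m} (hf : IsAntidominant f)
    {σ : (typeB d).Group} (hσ : σ ∈ repsInB f) {i : Fin d} (hi : IsDescent i (act f σ)) :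
    σ * (typeB d).toCoxeterSystem.simple i ∈ repsInB f ∧
      (typeB d).toCoxeterSystem.IsRightDescent σ i := by
  obtain ⟨n, hn⟩ := (mem_repsInB_iff hf).1 hσ
  obtain ⟨k, τ, hk⟩ := exists_descPath hf (σ * (typeB d).toCoxeterSystem.simple i)
  have hk' := hk
  rw [act_mul, act_simple] at hk'
  obtain ⟨e₁, e₂⟩ := hn.unique hf (.cons i hk' hi)
  have e₃ : σ * (typeB d).toCoxeterSystem.simple i = τ := by
    rw [e₂, CoxeterSystem.simple_mul_simple_cancel_right]
  refine ⟨(mem_repsInB_iff hf).2 ⟨k, by rw [e₃] at hk ⊢; exact hk⟩, ?_⟩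
  unfold CoxeterSystem.IsRightDescent
  rw [e₃, hk.length_eq hf, hn.length_eq hf, e₁]
  omega

theorem mul_simple_mem_repsInB_of_isDescent_simpleAct {f : LetterWord d r m}
    (hf : IsAntidominant f) {σ : (typeB d).Group} (hσ : σ ∈ repsInB f) {i : Fin d}
    (hi : IsDescent i (simpleAct i (act f σ))) :
    σ * (typeB d).toCoxeterSystem.simple i ∈ repsInB f ∧
      ¬ (typeB d).toCoxeterSystem.IsRightDescent σ i := by
  obtain ⟨n, hn⟩ := (mem_repsInB_iff hf).1 hσ
  have h : DescPath f (n + 1) (σ * (typeB d).toCoxeterSystem.simple i)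
      (simpleAct i (act f σ)) := .cons i (by rwa [simpleAct_simpleAct]) hi
  refine ⟨(mem_repsInB_iff hf).2 ⟨n + 1, by rwa [act_mul, act_simple]⟩, ?_⟩
  rw [CoxeterSystem.not_isRightDescent_iff, h.length_eq hf, hn.length_eq hf]

theorem mul_simple_notMem_repsInB {f : LetterWord d r m} (hf : IsAntidominant f)
    {σ : (typeB d).Group} (hσ : σ ∈ repsInB f) {i : Fin d}
    (hi : simpleAct i (act f σ) = act f σ) :
    σ * (typeB d).toCoxeterSystem.simple i ∉ repsInB f ∧
      ¬ (typeB d).toCoxeterSystem.IsRightDescent σ i := by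
  have e : act f (σ * (typeB d).toCoxeterSystem.simple i) = act f σ := by
    rw [act_mul, act_simple, hi]
  constructor
  · intro h
    have h' := injOn_act_repsInB hf h hσ e
    apply (typeB d).toCoxeterSystem.length_mul_simple_ne σ i
    rw [h']
  · exact not_lt.2 (mem_repsInB_iff_forall.1 hσ _ e)

end Words

/-! ### The action on the cyclic module generated by an antidominant tensor -/

section Action

variable {K : Type*} [CommRing K] {d r m : ℕ} (p q : Kˣ)

theorem genAct_of_isDescent {i : Fin d} {g : LetterWord d r m} (h : IsDescent i g) :
    genAct p q i (stdTensor K g) = stdTensor K (simpleAct i g) +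
      ((typeBParam d p q i : K) - (((typeBParam d p q i)⁻¹ : Kˣ) : K)) • stdTensor K g := by
  unfold typeBParam
  by_cases hi : i.1 = 0
  · rw [isDescent_zero hi] at h
    rw [genAct_zero p q i hi, if_neg h.not_isMiddle, if_pos h, if_pos hi]
  · rw [isDescent_pos hi] at h
    rw [genAct_pos p q i hi, if_pos h, if_neg hi]

theorem genAct_of_isDescent_simpleAct {i : Fin d} {g : LetterWord d r m}
    (h : IsDescent i (simpleAct i g)) :
    genAct p q i (stdTensor K g) = stdTensor K (simpleAct i g) := by
  by_cases hi : i.1 = 0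
  · rw [isDescent_zero hi, simpleAct_zero i hi] at h
    rw [genAct_zero p q i hi]
    by_cases h1 : IsMiddle (g i)
    · rw [if_pos h1] at h
      exact absurd h1 h.not_isMiddle
    · rw [if_neg h1, Function.update_self, isUpper_rev _ h1] at h
      rw [if_neg h1, if_neg h]
  · rw [isDescent_pos hi, simpleAct_pos i hi] at h
    simp only [Function.comp_apply, Equiv.swap_apply_left, Equiv.swap_apply_right] at h
    rw [genAct_pos p q i hi, if_neg (not_lt_of_gt h), if_pos h]

theorem genAct_of_simpleAct_eq {i : Fin d} {g : LetterWord d r m} (h : simpleAct i g = g) :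
    genAct p q i (stdTensor K g) = (typeBParam d p q i : K) • stdTensor K g := by
  unfold typeBParam
  by_cases hi : i.1 = 0
  · rw [genAct_zero p q i hi, if_pos hi]
    rw [simpleAct_zero i hi] at h
    by_cases h1 : IsMiddle (g i)
    · rw [if_pos h1]
    · -- a letter outside the middle part is not its own negative
      exfalso
      rw [if_neg h1] at h
      have h2 := congrFun h i
      rw [Function.update_self] at h2
      have h3 := isUpper_rev (g i) h1
      rw [h2] at h3
      tauto
  · rw [genAct_pos p q i hi, if_neg hi]
    rw [simpleAct_pos i hi] at h
    have h2 := congrFun h i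
    simp only [Function.comp_apply, Equiv.swap_apply_right] at h2
    rw [h2, if_neg (lt_irrefl _), if_neg (lt_irrefl _)]

end Action

/-! ### A basis of an induced module -/

section InducedBasis

variable {K A H : Type*} [CommRing K] [Ring A] [Algebra K A] [Ring H] [Algebra K H]
  (ι : A →ₐ[K] H) {N : Type*} [AddCommGroup N] [Module K N] [Module Aᵐᵒᵖ N]

/-- The canonical map `(h, n) ↦ n ⊗ h`, linear in both variables over the base ring. -/
noncomputable def indTmulHom : H →ₗ[K] N →ₗ[K] InducedModule ι N :=
  LinearMap.mk₂ K (fun h n => indTmul ι n h)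
    (fun h h' n => by
      unfold indTmul; rw [TensorProduct.add_tmul]; rfl)
    (fun c h n => (smul_indTmul ι c n h).symm)
    (fun h n n' => by
      unfold indTmul; rw [TensorProduct.tmul_add]; rfl)
    (fun c h n => by
      rw [smul_indTmul]; unfold indTmul; rw [TensorProduct.smul_tmul])

@[simp] theorem indTmulHom_apply (h : H) (n : N) : indTmulHom ι h n = indTmul ι n h := rfl

theorem inducedModule_induction {P : InducedModule ι N → Prop} (z : InducedModule ι N)
    (zero : P 0) (tmul : ∀ n h, P (indTmul ι n h)) (add : ∀ x y, P x → P y → P (x + y)) :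
    P z := by
  obtain ⟨z, rfl⟩ := Submodule.Quotient.mk_surjective _ z
  induction z using TensorProduct.induction_on with
  | zero => exact zero
  | tmul h n => exact tmul n h
  | add x y hx hy => exact add _ _ hx hy

/-- A `K`-linear map on `H ⊗ N` that is balanced over `A` descends to the induced module. -/
noncomputable def inducedLift {V : Type*} [AddCommGroup V] [Module K V]
    (Ψ : H →ₗ[K] N →ₗ[K] V) (hΨ : ∀ (a : A) (h : H) (n : N), Ψ h (op a • n) = Ψ (ι a * h) n) :
    InducedModule ι N →ₗ[K] V :=
  ((Submodule.restrictScalars K (Submodule.span Hᵐᵒᵖ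
      {z : H ⊗[K] N | ∃ (a : A) (h : H) (n : N),
        z = h ⊗ₜ[K] (op a • n) - (ι a * h) ⊗ₜ[K] n})).liftQ (TensorProduct.lift Ψ) (by
    intro z hz
    rw [Submodule.restrictScalars_mem] at hz
    rw [LinearMap.mem_ker]
    induction hz using Submodule.closure_induction with
    | zero => exact map_zero _
    | add x y _ _ hx hy => rw [map_add, hx, hy, add_zero]
    | smul_mem c x hx =>
      obtain ⟨a, h, n, rfl⟩ := hx
      obtain ⟨c, rfl⟩ := op_surjective c
      rw [smul_sub, TensorProduct.smul_tmul', TensorProduct.smul_tmul', map_sub,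
        TensorProduct.lift.tmul, TensorProduct.lift.tmul, hΨ, sub_eq_zero, op_smul_eq_mul,
        op_smul_eq_mul, mul_assoc])).comp
    (Submodule.Quotient.restrictScalarsEquiv K (Submodule.span Hᵐᵒᵖ
      {z : H ⊗[K] N | ∃ (a : A) (h : H) (n : N),
        z = h ⊗ₜ[K] (op a • n) - (ι a * h) ⊗ₜ[K] n})).symm.toLinearMap

@[simp] theorem inducedLift_indTmul {V : Type*} [AddCommGroup V] [Module K V]
    (Ψ : H →ₗ[K] N →ₗ[K] V) (hΨ) (n : N) (h : H) :
    inducedLift ι Ψ hΨ (indTmul ι n h) = Ψ h n := rfl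

end InducedBasis

section InducedHecke

open HeckeAlgebra

variable {K B B' W : Type*} [CommRing K] [Group W] {M : CoxeterMatrix B} {M' : CoxeterMatrix B'}
  (cs : CoxeterSystem M W) {j : B' → B} (hj : ∀ a b, M (j a) (j b) = M' a b)
  {q : B → Kˣ} {q' : B' → Kˣ} (hqj : ∀ a, q (j a) = q' a)
  {N : Type*} [AddCommGroup N] [Module K N] [Module (HeckeAlgebra K M' q')ᵐᵒᵖ N]
  [IsScalarTower K (HeckeAlgebra K M' q')ᵐᵒᵖ N]

/-- The factorization of the elements of `W` into an element of a standard parabolic subgroup and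
a minimal right coset representative. -/
noncomputable def cosetEquiv :
    M'.Group × minReps cs (parabolicHom cs j hj).range ≃ W :=
  Equiv.ofBijective (fun z => parabolicHom cs j hj z.1 * z.2) (by
    constructor
    · rintro ⟨y, x, hx⟩ ⟨y', x', hx'⟩ h
      obtain ⟨rfl, rfl⟩ := eq_of_parabolicHom_mul_eq cs j hj hx hx' h
      rfl
    · intro w
      obtain ⟨y, x, hx, rfl⟩ := exists_eq_parabolicHom_mul cs j hj w
      exact ⟨(y, ⟨x, hx⟩), rfl⟩)

theorem cosetEquiv_symm_mul (y : M'.Group) (x : minReps cs (parabolicHom cs j hj).range) :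
    (cosetEquiv cs hj).symm (parabolicHom cs j hj y * x) = (y, x) :=
  (cosetEquiv cs hj).symm_apply_apply (y, x)

variable (hq : ∀ s t : B, IsConj (cs.simple s) (cs.simple t) → q s = q t)

variable (q') in
/-- The map `H_{y x} ⊗ n ↦ (n H_y)` placed at `x`, for `y` in the parabolic subgroup and `x` a
minimal right coset representative. -/
noncomputable def cosetSplit : HeckeAlgebra K M q →ₗ[K] N →ₗ[K]
    (minReps cs (parabolicHom cs j hj).range →₀ N) :=
  (HeckeAlgebra.basis cs q hq).constr K fun w =>
    (Finsupp.lsingle ((cosetEquiv cs hj).symm w).2).comp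
      (Algebra.lsmul K K N
        (op (basisElt M'.toCoxeterSystem q' ((cosetEquiv cs hj).symm w).1)))

theorem cosetSplit_basisElt (y : M'.Group) (x : minReps cs (parabolicHom cs j hj).range) (n : N) :
    cosetSplit cs hj q' hq (basisElt cs q (parabolicHom cs j hj y * x)) n =
      Finsupp.single x (op (basisElt M'.toCoxeterSystem q' y) • n) := by
  rw [cosetSplit, ← basis_apply cs q hq, Module.Basis.constr_basis, cosetEquiv_symm_mul]
  rfl

theorem cosetSplit_parabolicMap_mul (a : HeckeAlgebra K M' q')
    (x : minReps cs (parabolicHom cs j hj).range) (n : N) :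
    cosetSplit cs hj q' hq (parabolicMap j hj hqj a * basisElt cs q x) n =
      Finsupp.single x (op a • n) := by
  have ha : a ∈ Submodule.span K (Set.range (basisElt M'.toCoxeterSystem q')) := by
    rw [span_range_basisElt]; trivial
  induction ha using Submodule.span_induction with
  | mem a ha =>
    obtain ⟨y, rfl⟩ := ha
    rw [← basisElt_parabolicHom_mul cs hj hqj x.2, cosetSplit_basisElt]
  | zero => simp
  | add a b _ _ ha hb =>
    rw [map_add, add_mul, map_add, LinearMap.add_apply, ha, hb, op_add, add_smul,
      Finsupp.single_add]
  | smul c a _ ha =>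
    rw [map_smul, smul_mul_assoc, map_smul, LinearMap.smul_apply, ha, op_smul, smul_assoc,
      Finsupp.smul_single]

/-- Induction over the Hecke algebra as a module over a parabolic subalgebra. -/
theorem induction_parabolic {P : HeckeAlgebra K M q → Prop} (h : HeckeAlgebra K M q)
    (zero : P 0)
    (mul : ∀ (y : M'.Group) (x : minReps cs (parabolicHom cs j hj).range),
      P (parabolicMap j hj hqj (basisElt M'.toCoxeterSystem q' y) * basisElt cs q x))
    (add : ∀ a b, P a → P b → P (a + b)) (smul : ∀ (c : K) a, P a → P (c • a)) : P h := by
  have ha : h ∈ Submodule.span K (Set.range (basisElt cs q)) := by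
    rw [span_range_basisElt]; trivial
  induction ha using Submodule.span_induction with
  | mem a ha =>
    obtain ⟨w, rfl⟩ := ha
    obtain ⟨y, x, hx, rfl⟩ := exists_eq_parabolicHom_mul cs j hj w
    rw [basisElt_parabolicHom_mul cs hj hqj hx]
    exact mul y ⟨x, hx⟩
  | zero => exact zero
  | add a b _ _ ha hb => exact add a b ha hb
  | smul c a _ ha => exact smul c a ha

/-- The right action of the parabolic subalgebra on `N` matches its left action on the Hecke
algebra. -/
theorem cosetSplit_balanced (a : HeckeAlgebra K M' q') (h : HeckeAlgebra K M q) (n : N) :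
    cosetSplit cs hj q' hq h (op a • n) = cosetSplit cs hj q' hq (parabolicMap j hj hqj a * h) n := by
  induction h using induction_parabolic cs hj hqj with
  | zero => simp
  | mul y x =>
    rw [← mul_assoc, ← map_mul, cosetSplit_parabolicMap_mul, cosetSplit_parabolicMap_mul, op_mul,
      mul_smul]
  | add b c hb hc => rw [map_add, LinearMap.add_apply, hb, hc, mul_add, map_add,
      LinearMap.add_apply]
  | smul c b hb => rw [mul_smul_comm, (cosetSplit cs hj q' hq).map_smul,
      (cosetSplit cs hj q' hq).map_smul, LinearMap.smul_apply, hb, LinearMap.smul_apply]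

/-- As a `K`-module, a module induced from a parabolic subalgebra is a direct sum of copies of the
given module, one for each minimal right coset representative. -/
noncomputable def inducedEquiv : InducedModule (parabolicMap j hj hqj) N ≃ₗ[K]
    (minReps cs (parabolicHom cs j hj).range →₀ N) :=
  LinearEquiv.ofLinearMap
    (inducedLift (parabolicMap j hj hqj) (cosetSplit cs hj q' hq) (cosetSplit_balanced cs hj hqj hq))
    (Finsupp.lsum K fun x => indTmulHom (parabolicMap j hj hqj) (basisElt cs q (x : W)))
    (by
      ext x n : 2
      have h := cosetSplit_parabolicMap_mul cs hj hqj hq 1 x n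
      rw [map_one, one_mul, op_one, one_smul] at h
      simp only [LinearMap.comp_apply, Finsupp.lsingle_apply, LinearMap.id_apply]
      rw [Finsupp.lsum_single, indTmulHom_apply, inducedLift_indTmul, h])
    (by
      refine LinearMap.ext fun z => ?_
      induction z using inducedModule_induction with
      | zero => simp
      | add z z' hz hz' => rw [map_add, hz, hz', map_add]
      | tmul n h =>
        induction h using induction_parabolic cs hj hqj with
        | zero =>
          rw [← indTmulHom_apply, map_zero, LinearMap.zero_apply, map_zero, map_zero]
        | mul y x =>
          rw [LinearMap.comp_apply, inducedLift_indTmul, cosetSplit_parabolicMap_mul,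
            Finsupp.lsum_single, indTmulHom_apply, indTmul_balanced]
          rfl
        | add a b ha hb =>
          rw [← indTmulHom_apply, map_add, LinearMap.add_apply, map_add, map_add,
            indTmulHom_apply, indTmulHom_apply, ha, hb]
        | smul c a ha =>
          rw [← indTmulHom_apply, map_smul, LinearMap.smul_apply, map_smul, map_smul,
            indTmulHom_apply, ha])

/-- The basis `(n_i ⊗ H_x)` of an induced module. -/
noncomputable def inducedBasis {I : Type*} (b : Module.Basis I K N) :
    Module.Basis (Σ _ : minReps cs (parabolicHom cs j hj).range, I) K
      (InducedModule (parabolicMap j hj hqj) N) :=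
  (Finsupp.basis fun _ => b).map (inducedEquiv cs hj hqj hq).symm

theorem inducedBasis_apply {I : Type*} (b : Module.Basis I K N)
    (x : minReps cs (parabolicHom cs j hj).range) (i : I) :
    inducedBasis cs hj hqj hq b ⟨x, i⟩ =
      indTmul (parabolicMap j hj hqj) (b i) (basisElt cs q (x : W)) := by
  rw [inducedBasis, Module.Basis.map_apply, Finsupp.coe_basis]
  change Finsupp.lsum K (fun x : minReps cs (parabolicHom cs j hj).range =>
    indTmulHom (parabolicMap j hj hqj) (basisElt cs q (x : W))) (Finsupp.single x (b i)) = _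
  rw [Finsupp.lsum_single]
  rfl

end InducedHecke

/-! ### The standard basis of the quasi-permutation module -/

section QuasiPermBasis

variable {K : Type*} [CommRing K] {d r m : ℕ} (p q : Kˣ)

theorem stdElt_congr {f : LetterWord d r m} {σ τ : (typeB d).Group} (h : act f σ = act f τ) :
    stdElt (K := K) p q f σ = stdElt p q f τ :=
  Subtype.ext (congrArg (stdTensor K) h)

theorem op_gen_smul_stdElt (f : LetterWord d r m) (σ : (typeB d).Group) (i : Fin d) :
    op (HeckeAlgebra.gen (typeB d) (typeBParam d p q) i) • stdElt (K := K) p q f σ =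
      stdElt p q f (σ * (typeB d).toCoxeterSystem.simple i) +
        actCoeff p q i (act f σ) • stdElt p q f σ := by
  apply Subtype.ext
  change op (HeckeAlgebra.gen (typeB d) (typeBParam d p q) i) • stdTensor K (act f σ) =
    stdTensor K (act f (σ * (typeB d).toCoxeterSystem.simple i)) +
      actCoeff p q i (act f σ) • stdTensor K (act f σ)
  rw [op_gen_smul, genAct_stdTensor, act_mul, act_simple]

theorem op_smul_mem_span_stdElt (f : LetterWord d r m) (a : HeckeB d p q) :
    ∀ v ∈ Submodule.span K (Set.range (stdElt (K := K) p q f)),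
      op a • v ∈ Submodule.span K (Set.range (stdElt (K := K) p q f)) := by
  induction a using HeckeAlgebra.induction_on with
  | algebraMap c =>
    intro v hv
    rw [Algebra.algebraMap_eq_smul_one, op_smul, op_one, smul_assoc, one_smul]
    exact Submodule.smul_mem _ _ hv
  | gen i =>
    intro v hv
    induction hv using Submodule.span_induction with
    | mem v hv =>
      obtain ⟨σ, rfl⟩ := hv
      rw [op_gen_smul_stdElt]
      exact add_mem (Submodule.subset_span ⟨_, rfl⟩)
        (Submodule.smul_mem _ _ (Submodule.subset_span ⟨_, rfl⟩))
    | zero => rw [smul_zero]; exact zero_mem _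
    | add v w _ _ hv hw => rw [smul_add]; exact add_mem hv hw
    | smul c v _ hv => rw [smul_comm]; exact Submodule.smul_mem _ _ hv
  | add a b ha hb =>
    intro v hv
    rw [op_add, add_smul]
    exact add_mem (ha v hv) (hb v hv)
  | mul a b ha hb =>
    intro v hv
    rw [op_mul, mul_smul]
    exact hb _ (ha v hv)

theorem span_range_stdElt (f : LetterWord d r m) :
    Submodule.span K (Set.range (stdElt (K := K) p q f)) = ⊤ := by
  rw [eq_top_iff]
  rintro ⟨v, hv⟩ -
  obtain ⟨a, rfl⟩ := Submodule.mem_span_singleton.1 hv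
  have h := op_smul_mem_span_stdElt (K := K) p q f a.unop (stdElt p q f 1)
    (Submodule.subset_span ⟨1, rfl⟩)
  have e : stdElt (K := K) p q f 1 = ⟨stdTensor K f, Submodule.subset_span rfl⟩ :=
    Subtype.ext (congrArg (stdTensor K) (act_one f))
  rw [e] at h
  exact h

/-- The basis of `𝕄_f` formed by the elements `M_{f·σ}`, with `σ` running over the minimal right
coset representatives of the stabilizer. -/
noncomputable def quasiPermBasis {f : LetterWord d r m} (hf : IsAntidominant f) :
    Module.Basis (repsInB f) K (QuasiPerm (K := K) p q f) :=
  .mk (v := fun σ : repsInB f => stdElt p q f σ) (by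
    apply LinearIndependent.of_comp ((QuasiPerm (K := K) p q f).subtype.restrictScalars K)
    have : ((QuasiPerm (K := K) p q f).subtype.restrictScalars K) ∘
        (fun σ : repsInB f => stdElt p q f σ) =
        stdBasis K d r m ∘ fun σ : repsInB f => act f σ := by
      funext σ
      exact (stdBasis_apply K _).symm
    rw [this]
    exact (stdBasis K d r m).linearIndependent.comp _
      fun σ τ h => Subtype.ext (injOn_act_repsInB hf σ.2 τ.2 h)) (by
    rw [← span_range_stdElt, Submodule.span_le]
    rintro _ ⟨τ, rfl⟩
    obtain ⟨σ, hσ, h⟩ := exists_mem_repsInB_act_eq hf τ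
    exact Submodule.subset_span ⟨⟨σ, hσ⟩, stdElt_congr p q h⟩)

@[simp] theorem quasiPermBasis_apply {f : LetterWord d r m} (hf : IsAntidominant f)
    (σ : repsInB f) : quasiPermBasis (K := K) p q hf σ = stdElt p q f σ := by
  rw [quasiPermBasis, Module.Basis.mk_apply]

theorem op_gen_smul_stdElt_of_isDescent {f : LetterWord d r m} {σ : (typeB d).Group} {i : Fin d}
    (h : IsDescent i (act f σ)) :
    op (HeckeAlgebra.gen (typeB d) (typeBParam d p q) i) • stdElt (K := K) p q f σ =
      stdElt p q f (σ * (typeB d).toCoxeterSystem.simple i) +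
        ((typeBParam d p q i : K) - (((typeBParam d p q i)⁻¹ : Kˣ) : K)) • stdElt p q f σ := by
  apply Subtype.ext
  refine (op_gen_smul i (stdTensor K (act f σ))).trans ((genAct_of_isDescent p q h).trans ?_)
  rw [← act_simple, ← act_mul]
  rfl

theorem op_gen_smul_stdElt_of_isDescent_simpleAct {f : LetterWord d r m} {σ : (typeB d).Group}
    {i : Fin d} (h : IsDescent i (simpleAct i (act f σ))) :
    op (HeckeAlgebra.gen (typeB d) (typeBParam d p q) i) • stdElt (K := K) p q f σ =
      stdElt p q f (σ * (typeB d).toCoxeterSystem.simple i) := by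
  apply Subtype.ext
  refine (op_gen_smul i (stdTensor K (act f σ))).trans
    ((genAct_of_isDescent_simpleAct p q h).trans ?_)
  rw [← act_simple, ← act_mul]
  rfl

theorem op_gen_smul_stdElt_of_simpleAct_eq {f : LetterWord d r m} {σ : (typeB d).Group}
    {i : Fin d} (h : simpleAct i (act f σ) = act f σ) :
    op (HeckeAlgebra.gen (typeB d) (typeBParam d p q) i) • stdElt (K := K) p q f σ =
      (typeBParam d p q i : K) • stdElt p q f σ :=
  Subtype.ext ((op_gen_smul i (stdTensor K (act f σ))).trans (genAct_of_simpleAct_eq p q h))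

end QuasiPermBasis

/-! ### The standard basis of the induced quasi-permutation module -/

section StdBasis

variable {K B W : Type*} [CommRing K] [Group W] {M : CoxeterMatrix B} (cs : CoxeterSystem M W)
  {qs : B → Kˣ} (hqs : ∀ s t : B, IsConj (cs.simple s) (cs.simple t) → qs s = qs t)
  {d r m : ℕ} {j : Fin d → B} (hj : ∀ a b, M (j a) (j b) = typeB d a b)
  {p q : Kˣ} (hpq : ∀ a, qs (j a) = typeBParam d p q a)
  {f : LetterWord d r m} (hf : IsAntidominant f)

/-- The bijection `(x, σ) ↦ σ x` between pairs of minimal representatives and minimal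
representatives in `W`. -/
noncomputable def repsEquiv (f : LetterWord d r m) :
    (Σ _ : minReps cs (parabolicHom cs j hj).range, repsInB f) ≃ repsInW cs j hj f :=
  ((Equiv.sigmaEquivProd _ _).trans (Equiv.prodComm _ _)).trans
    ((Equiv.Set.prod _ _).symm.trans
      (Set.BijOn.equiv _ (bijOn_parabolicHom_mul cs j hj (stab f))))

/-- The standard basis `m_{σ x} = M_{f·σ} ⊗ H_x` of the induced module. -/
noncomputable def stdInducedBasis :
    Module.Basis (repsInW cs j hj f) K (InducedQuasiPerm hj hpq f) :=
  (inducedBasis cs hj hpq hqs (quasiPermBasis p q hf)).reindex (repsEquiv cs hj f)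

theorem stdInducedBasis_apply (w : repsInW cs j hj f) {σ : (typeB d).Group} {x : W}
    (hσ : σ ∈ repsInB f) (hx : x ∈ repsOfB cs j hj) (hw : (w : W) = parabolicHom cs j hj σ * x) :
    stdInducedBasis cs hqs hj hpq hf w = stdInduced cs hj hpq f σ x := by
  have e : w = repsEquiv cs hj f ⟨⟨x, hx⟩, ⟨σ, hσ⟩⟩ := Subtype.ext hw
  rw [e, stdInducedBasis, Module.Basis.reindex_apply, Equiv.symm_apply_apply, inducedBasis_apply,
    quasiPermBasis_apply]
  rfl

theorem op_smul_stdInduced (σ : (typeB d).Group) (x : W) (h : HeckeAlgebra K M qs) :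
    op h • stdInduced cs hj hpq f σ x =
      indTmul _ (stdElt p q f σ) (HeckeAlgebra.basisElt cs qs x * h) := rfl

/-- If `x s = s_i x`, then `H_s` acts on `n ⊗ H_x` through the action of `H_i` on `n`. -/
theorem op_gen_smul_indTmul {x : W} (hx : x ∈ repsOfB cs j hj) {s : B} {i : Fin d}
    (h : cs.simple (j i) * x = x * cs.simple s) (n : QuasiPerm (K := K) p q f) :
    op (HeckeAlgebra.gen M qs s) •
        indTmul (HeckeAlgebra.parabolicMap j hj hpq) n (HeckeAlgebra.basisElt cs qs x) =
      indTmul (HeckeAlgebra.parabolicMap j hj hpq)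
        (op (HeckeAlgebra.gen (typeB d) (typeBParam d p q) i) • n)
        (HeckeAlgebra.basisElt cs qs x) := by
  have hl := (mem_minReps_range_iff cs j hj).1 hx i
  have hr : ¬ cs.IsRightDescent x s := by
    unfold CoxeterSystem.IsLeftDescent at hl
    unfold CoxeterSystem.IsRightDescent
    rwa [← h]
  rw [op_smul_indTmul, ← HeckeAlgebra.basisElt_mul_simple cs qs hr, ← h, indTmul_balanced,
    ← HeckeAlgebra.basisElt_simple (typeB d).toCoxeterSystem,
    ← HeckeAlgebra.basisElt_parabolicHom_mul cs hj hpq hx, parabolicHom_simple]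

/-- The action of a generator `H_s` on the standard basis. By Deodhar's lemma, either `x s` is again
a minimal representative of the parabolic subgroup and `H_s` acts on the second factor, or
`x s = s_i x` and it acts on the first factor. -/
theorem op_gen_smul_stdInducedBasis (w : repsInW cs j hj f) (s : B) :
    (cs.length (w * cs.simple s) < cs.length (w : W) →
      ∃ h : (w : W) * cs.simple s ∈ repsInW cs j hj f,
        op (HeckeAlgebra.gen M qs s) • stdInducedBasis cs hqs hj hpq hf w =
          stdInducedBasis cs hqs hj hpq hf ⟨w * cs.simple s, h⟩ +
            ((qs s : K) - (((qs s)⁻¹ : Kˣ) : K)) • stdInducedBasis cs hqs hj hpq hf w) ∧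
    (cs.length (w : W) < cs.length (w * cs.simple s) →
      ∀ h : (w : W) * cs.simple s ∈ repsInW cs j hj f,
        op (HeckeAlgebra.gen M qs s) • stdInducedBasis cs hqs hj hpq hf w =
          stdInducedBasis cs hqs hj hpq hf ⟨w * cs.simple s, h⟩) ∧
    (cs.length (w : W) < cs.length (w * cs.simple s) →
      (w : W) * cs.simple s ∉ repsInW cs j hj f →
        op (HeckeAlgebra.gen M qs s) • stdInducedBasis cs hqs hj hpq hf w =
          (qs s : K) • stdInducedBasis cs hqs hj hpq hf w) := by
  obtain ⟨⟨⟨x, hx⟩, ⟨σ, hσ⟩⟩, rfl⟩ := (repsEquiv cs hj f).surjective w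
  have hx' : x ∈ minReps cs (parabolicHom cs j hj).range := hx
  set w := repsEquiv cs hj f ⟨⟨x, hx⟩, ⟨σ, hσ⟩⟩
  have hw : (w : W) = parabolicHom cs j hj σ * x := rfl
  have hstd := stdInducedBasis_apply cs hqs hj hpq hf w hσ hx hw
  have hlw : cs.length (w : W) = (typeB d).toCoxeterSystem.length σ + cs.length x :=
    length_parabolicHom_mul cs j hj hx' σ
  rw [hstd]
  rcases mul_simple_mem_minReps_or cs j hj hx' s with hxs | ⟨i, hi⟩
  · have hws : (w : W) * cs.simple s = parabolicHom cs j hj σ * (x * cs.simple s) := by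
      rw [hw, mul_assoc]
    have hmem : (w : W) * cs.simple s ∈ repsInW cs j hj f := by
      rw [hws]
      exact (parabolicHom_mul_mem_minReps_map_iff cs j hj hxs).2 hσ
    have hlws : cs.length ((w : W) * cs.simple s) =
        (typeB d).toCoxeterSystem.length σ + cs.length (x * cs.simple s) := by
      rw [hws]
      exact length_parabolicHom_mul cs j hj hxs σ
    have hstd' := stdInducedBasis_apply cs hqs hj hpq hf ⟨_, hmem⟩ hσ hxs hws
    rw [hlw, hlws]
    refine ⟨fun hl => ⟨hmem, ?_⟩, fun hl hmem => ?_, fun _ h => absurd hmem h⟩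
    · have hd : cs.IsRightDescent x s := by
        unfold CoxeterSystem.IsRightDescent
        omega
      rw [hstd', op_smul_stdInduced, HeckeAlgebra.basisElt_mul_gen_of_isRightDescent cs qs hd,
        ← indTmulHom_apply, map_add, LinearMap.add_apply, map_smul, LinearMap.smul_apply]
      rfl
    · have hd : ¬ cs.IsRightDescent x s := by
        unfold CoxeterSystem.IsRightDescent
        omega
      rw [hstd', op_smul_stdInduced, ← HeckeAlgebra.basisElt_mul_simple cs qs hd]
      rfl
  · have hws : (w : W) * cs.simple s =
        parabolicHom cs j hj (σ * (typeB d).toCoxeterSystem.simple i) * x := by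
      rw [hw, map_mul, parabolicHom_simple, mul_assoc, mul_assoc, hi]
    have hlws : cs.length ((w : W) * cs.simple s) =
        (typeB d).toCoxeterSystem.length (σ * (typeB d).toCoxeterSystem.simple i) +
          cs.length x := by
      rw [hws]
      exact length_parabolicHom_mul cs j hj hx' _
    have hmem : (w : W) * cs.simple s ∈ repsInW cs j hj f ↔
        σ * (typeB d).toCoxeterSystem.simple i ∈ repsInB f := by
      rw [hws]
      exact parabolicHom_mul_mem_minReps_map_iff cs j hj hx'
    have hq : qs s = typeBParam d p q i := by
      rw [← hpq]
      apply hqs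
      rw [isConj_iff]
      exact ⟨x, by rw [← hi, mul_inv_cancel_right]⟩
    have hact : op (HeckeAlgebra.gen M qs s) • stdInduced cs hj hpq f σ x =
        indTmul (HeckeAlgebra.parabolicMap j hj hpq)
          (op (HeckeAlgebra.gen (typeB d) (typeBParam d p q) i) • stdElt p q f σ)
          (HeckeAlgebra.basisElt cs qs x) := op_gen_smul_indTmul cs hj hpq hx hi _
    rw [hact, hlw, hlws, hq]
    rcases isDescent_or i (act f σ) with hd | hd | hd
    · obtain ⟨hmem', hdesc⟩ := mul_simple_mem_repsInB_of_isDescent hf hσ hd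
      unfold CoxeterSystem.IsRightDescent at hdesc
      refine ⟨fun _ => ⟨hmem.2 hmem', ?_⟩, by omega, by omega⟩
      rw [stdInducedBasis_apply cs hqs hj hpq hf ⟨_, hmem.2 hmem'⟩ hmem' hx hws,
        op_gen_smul_stdElt_of_isDescent p q hd, ← indTmulHom_apply, map_add, map_smul]
      rfl
    · obtain ⟨hmem', hdesc⟩ := mul_simple_notMem_repsInB hf hσ hd
      unfold CoxeterSystem.IsRightDescent at hdesc
      refine ⟨by omega, fun _ h => absurd (hmem.1 h) hmem', fun _ _ => ?_⟩
      rw [op_gen_smul_stdElt_of_simpleAct_eq p q hd, ← indTmulHom_apply, map_smul]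
      rfl
    · obtain ⟨hmem', hdesc⟩ := mul_simple_mem_repsInB_of_isDescent_simpleAct hf hσ hd
      unfold CoxeterSystem.IsRightDescent at hdesc
      refine ⟨by omega, fun _ h => ?_, fun _ h => absurd (hmem.2 hmem') h⟩
      rw [stdInducedBasis_apply cs hqs hj hpq hf ⟨_, h⟩ hmem' hx hws,
        op_gen_smul_stdElt_of_isDescent_simpleAct p q hd]
      rfl

end StdBasis

end QuasiParabolic

open QuasiParabolic in
theorem mainTheorem3 {K B W : Type*} [CommRing K] [Group W] {M : CoxeterMatrix B}
    (cs : CoxeterSystem M W) (qs : B → Kˣ)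
    (hqs : ∀ s t : B, IsConj (cs.simple s) (cs.simple t) → qs s = qs t)
    (d r m : ℕ) (j : Fin d → B) (hj : ∀ a b, M (j a) (j b) = typeB d a b)
    (p q : Kˣ) (hpq : ∀ a, qs (j a) = typeBParam d p q a)
    (f : LetterWord d r m) (hf : IsAntidominant f) :
    Set.BijOn (fun z : (typeB d).Group × W => parabolicHom cs j hj z.1 * z.2)
      (repsInB f ×ˢ repsOfB cs j hj) (repsInW cs j hj f) ∧
    ∃ std : Module.Basis (repsInW cs j hj f) K (InducedQuasiPerm hj hpq f),
      (∀ (w : repsInW cs j hj f) (σ : (typeB d).Group) (x : W),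
        σ ∈ repsInB f → x ∈ repsOfB cs j hj → (w : W) = parabolicHom cs j hj σ * x →
          std w = stdInduced cs hj hpq f σ x) ∧
      ∀ (w : repsInW cs j hj f) (s : B),
        (cs.length (w * cs.simple s) < cs.length (w : W) →
          ∃ h : (w : W) * cs.simple s ∈ repsInW cs j hj f,
            op (HeckeAlgebra.gen M qs s) • std w =
              std ⟨w * cs.simple s, h⟩ + ((qs s : K) - (((qs s)⁻¹ : Kˣ) : K)) • std w) ∧
        (cs.length (w : W) < cs.length (w * cs.simple s) →
          ∀ h : (w : W) * cs.simple s ∈ repsInW cs j hj f,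
            op (HeckeAlgebra.gen M qs s) • std w = std ⟨w * cs.simple s, h⟩) ∧
        (cs.length (w : W) < cs.length (w * cs.simple s) →
          (w : W) * cs.simple s ∉ repsInW cs j hj f →
            op (HeckeAlgebra.gen M qs s) • std w = (qs s : K) • std w) :=
  ⟨bijOn_parabolicHom_mul cs j hj (stab f), stdInducedBasis cs hqs hj hpq hf,
    fun w _ _ hσ hx hw => stdInducedBasis_apply cs hqs hj hpq hf w hσ hx hw,
    op_gen_smul_stdInducedBasis cs hqs hj hpq hf⟩
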